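/- Let $X$ be a locally compact Hausdorff space, let $n$ be a natural number, and let $\mathcal{E}$ be an $\mathbb{M}_n$-bundle over $X$, that is, a locally trivial bundle whose fibres $\mathcal{E}_x$ are C*-algebras and whose local trivializations are *-isomorphisms of the fibres onto the algebra $\mathbb{M}_n$ of complex $n\times n$ matrices (so the structure group is $\mathrm{Aut}(\mathbb{M}_n)=PU(n)$). Let $A=\Gamma_0(\mathcal{E})$ be the C*-algebra of continuous sections of $\mathcal{E}$ vanishing at infinity, with pointwise operations and the supremum norm. (For $n\ge 1$ these are, up to isomorphism, exactly the $n$-homogeneous C*-algebras, and $X$ is the primitive spectrum of $A$.) Let $M(A)$ be the multiplier algebra of $A$ and, in the Banach space $\mathcal{B}(A)$ of bounded linear operators on $A$ with the operator norm, put $$\mathrm{TM}(A)=\{x\mapsto axb : a,b\in M(A)\},\qquad \mathrm{TM}_0(A)=\{x\mapsto axb : a,b\in A\}.$$ For an open set $U\subseteq X$, a complex line subbundle of $\mathcal{E}|_U$ is a family $\mathcal{L}=(\mathcal{L}_x)_{x\in U}$ of one-dimensional linear subspaces $\mathcal{L}_x\subseteq\mathcal{E}_x$ that is a locally trivial complex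 line bundle over $U$ in the topology induced from $\mathcal{E}$. It is called a phantom complex line subbundle if it is not trivial over $U$ but its restriction to every compact subset of $U$ is trivial. Then $\mathrm{TM}_0(A)$ fails to be norm closed in $\mathcal{B}(A)$ if and only if there exist a $\sigma$-compact open set $U\subseteq X$ and a phantom complex line subbundle of $\mathcal{E}|_U$. If these equivalent conditions hold, then $\mathrm{TM}(A)$ also fails to be norm closed in $\mathcal{B}(A)$. -/

import Mathlib

open Bundle Filter Topology
open scoped MultiplierAlgebra ENNReal

/-! ### Two-sided multiplications on a C*-algebra -/

section TwoSidedMultiplications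

variable (A : Type*) [NonUnitalCStarAlgebra A]

/-- The set `TM(A)` of two-sided multiplications `M_{a,b} : x ↦ a x b` on `A`, where `a` and `b`
range over the multiplier algebra of `A`; the product `a x b` is formed in the multiplier algebra
(where it lies in the ideal `A`). -/
def twoSidedMul : Set (A →L[ℂ] A) :=
  {φ | ∃ a b : 𝓜(ℂ, A), ∀ x : A, ((φ x : A) : 𝓜(ℂ, A)) = a * (x : 𝓜(ℂ, A)) * b}

/-- The set `TM₀(A)` of two-sided multiplications `M_{a,b} : x ↦ a x b` with `a, b ∈ A`. -/
def twoSidedMulZero : Set (A →L[ℂ] A) :=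
  {φ | ∃ a b : A, ∀ x : A, φ x = a * x * b}

end TwoSidedMultiplications

/-! ### Matrix bundles and their C*-algebras of sections -/

section Bundles

variable {X : Type*} [TopologicalSpace X] (n : ℕ) (E : X → Type*) [∀ x, CStarAlgebra (E x)]
  [TopologicalSpace (TotalSpace (Matrix (Fin n) (Fin n) ℂ) E)]

/-- The family of C*-algebras `E x`, `x ∈ X`, with the given topology on its total space, is an
`𝕄ₙ`-bundle over `X`: it is locally trivial with fibre the `n × n` complex matrices, through local
trivializations that are *-isomorphisms on each fibre. The transition functions are thus continuous
families of *-automorphisms of `𝕄ₙ`, that is, the structure group is `Aut(𝕄ₙ) = PU(n)`. -/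
class IsMatrixBundle : Prop where
  exists_trivialization : ∀ x : X,
    ∃ e : Trivialization (Matrix (Fin n) (Fin n) ℂ) (π (Matrix (Fin n) (Fin n) ℂ) E),
      x ∈ e.baseSet ∧ ∀ y ∈ e.baseSet, ∃ ψ : E y ≃⋆ₐ[ℂ] Matrix (Fin n) (Fin n) ℂ,
        ∀ v : E y, e ⟨y, v⟩ = (y, ψ v)

/-- Continuity of a (set-theoretic) section of the bundle. -/
def IsContinuousSection (s : ∀ x, E x) : Prop :=
  Continuous fun x ↦ (⟨x, s x⟩ : TotalSpace (Matrix (Fin n) (Fin n) ℂ) E)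

variable {n E}

section ContinuousSections

lemma continuousAt_section_iff {X : Type*} [TopologicalSpace X] {n : ℕ} {E : X → Type*}
    [TopologicalSpace (TotalSpace (Matrix (Fin n) (Fin n) ℂ) E)]
    (e : Trivialization (Matrix (Fin n) (Fin n) ℂ) (π (Matrix (Fin n) (Fin n) ℂ) E))
    (s : ∀ x, E x) {x : X} (hx : x ∈ e.baseSet) :
    ContinuousAt (fun x ↦ (⟨x, s x⟩ : TotalSpace (Matrix (Fin n) (Fin n) ℂ) E)) x ↔
      ContinuousAt (fun y ↦ (e ⟨y, s y⟩).2) x := by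
  unfold ContinuousAt
  rw [e.tendsto_nhds_iff (by rw [e.mem_source]; exact hx)]
  exact ⟨fun h ↦ h.2, fun h ↦ ⟨tendsto_id, h⟩⟩

variable [IsMatrixBundle n E]

lemma IsContinuousSection.zero : IsContinuousSection n E 0 := by
  refine continuous_iff_continuousAt.2 fun x ↦ ?_
  obtain ⟨e, hx, he⟩ := IsMatrixBundle.exists_trivialization (n := n) (E := E) x
  rw [continuousAt_section_iff e _ hx]
  refine (continuousAt_const (y := (0 : Matrix (Fin n) (Fin n) ℂ))).congr ?_
  filter_upwards [e.open_baseSet.mem_nhds hx] with y hy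
  obtain ⟨ψ, hψ⟩ := he y hy
  simp [hψ]

lemma IsContinuousSection.map₂ (f : ∀ x, E x → E x → E x)
    (g : Matrix (Fin n) (Fin n) ℂ → Matrix (Fin n) (Fin n) ℂ → Matrix (Fin n) (Fin n) ℂ)
    (hg : Continuous fun p : Matrix (Fin n) (Fin n) ℂ × Matrix (Fin n) (Fin n) ℂ ↦ g p.1 p.2)
    (hfg : ∀ x (ψ : E x ≃⋆ₐ[ℂ] Matrix (Fin n) (Fin n) ℂ) v w, ψ (f x v w) = g (ψ v) (ψ w))
    {s t : ∀ x, E x} (hs : IsContinuousSection n E s) (ht : IsContinuousSection n E t) :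
    IsContinuousSection n E (fun x ↦ f x (s x) (t x)) := by
  refine continuous_iff_continuousAt.2 fun x ↦ ?_
  obtain ⟨e, hx, he⟩ := IsMatrixBundle.exists_trivialization (n := n) (E := E) x
  have hs' := (continuousAt_section_iff e _ hx).1 hs.continuousAt
  have ht' := (continuousAt_section_iff e _ hx).1 ht.continuousAt
  rw [continuousAt_section_iff e _ hx]
  refine (hg.continuousAt.comp (hs'.prodMk ht')).congr ?_
  filter_upwards [e.open_baseSet.mem_nhds hx] with y hy
  obtain ⟨ψ, hψ⟩ := he y hy
  simp [hψ, hfg]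

open scoped Matrix.Norms.L2Operator in
/-- A uniform limit of continuous sections is a continuous section. -/
lemma IsContinuousSection.of_approx {s : ∀ x, E x}
    (h : ∀ ε > 0, ∃ t, IsContinuousSection n E t ∧ ∀ x, ‖s x - t x‖ < ε) :
    IsContinuousSection n E s := by
  refine continuous_iff_continuousAt.2 fun x ↦ ?_
  obtain ⟨e, hx, he⟩ := IsMatrixBundle.exists_trivialization (n := n) (E := E) x
  rw [continuousAt_section_iff e _ hx]
  refine continuousAt_of_locally_uniform_approx_of_continuousAt fun u hu ↦ ?_
  obtain ⟨ε, hε, hεu⟩ := Metric.mem_uniformity_dist.1 hu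
  obtain ⟨t, ht, hst⟩ := h ε hε
  refine ⟨e.baseSet, e.open_baseSet.mem_nhds hx, fun y ↦ (e ⟨y, t y⟩).2,
    (continuousAt_section_iff e _ hx).1 ht.continuousAt, fun y hy ↦ hεu ?_⟩
  obtain ⟨ψ, hψ⟩ := he y hy
  simp only [hψ]
  rw [dist_eq_norm, ← map_sub, StarAlgEquiv.norm_map]
  exact hst y

end ContinuousSections

variable (n E)
variable [IsMatrixBundle n E]

/-- The C*-algebra `Γ₀(E)` of continuous sections of `E` that vanish at infinity, with the
pointwise operations and the supremum norm, realized inside the C*-algebra `lp E ∞` of all bounded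
families `(s x)` with `s x ∈ E x`. -/
def sectionAlgebra : NonUnitalStarSubalgebra ℂ (lp E ∞) where
  carrier := {s | IsContinuousSection n E s ∧ Tendsto (fun x ↦ ‖s x‖) (cocompact X) (𝓝 0)}
  zero_mem' := ⟨IsContinuousSection.zero, by simpa using tendsto_const_nhds⟩
  add_mem' {s t} hs ht := by
    refine ⟨hs.1.map₂ (fun _ v w ↦ v + w) (fun v w ↦ v + w) continuous_add
      (fun _ ψ v w ↦ map_add ψ v w) ht.1, ?_⟩
    exact squeeze_zero (fun _ ↦ norm_nonneg _) (fun x ↦ norm_add_le (s x) (t x))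
      (by simpa using hs.2.add ht.2)
  mul_mem' {s t} hs ht := by
    refine ⟨hs.1.map₂ (fun _ v w ↦ v * w) (fun v w ↦ v * w) continuous_mul
      (fun _ ψ v w ↦ map_mul ψ v w) ht.1, ?_⟩
    exact squeeze_zero (fun _ ↦ norm_nonneg _) (fun x ↦ norm_mul_le (s x) (t x))
      (by simpa using hs.2.mul ht.2)
  smul_mem' c s hs := by
    refine ⟨hs.1.map₂ (fun _ v _ ↦ c • v) (fun v _ ↦ c • v) (by fun_prop)
      (fun _ ψ v _ ↦ map_smul ψ c v) hs.1, ?_⟩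
    have : Tendsto (fun x ↦ ‖c‖ * ‖s x‖) (cocompact X) (𝓝 0) := by
      simpa using hs.2.const_mul ‖c‖
    exact this.congr fun x ↦ (norm_smul c (s x)).symm
  star_mem' {s} hs := by
    refine ⟨hs.1.map₂ (fun _ v _ ↦ star v) (fun v _ ↦ star v) (by fun_prop)
      (fun _ ψ v _ ↦ map_star ψ v) hs.1, ?_⟩
    exact hs.2.congr fun x ↦ (norm_star (s x)).symm

instance isClosed_sectionAlgebra : IsClosed (sectionAlgebra n E : Set (lp E ∞)) := by
  refine isClosed_of_closure_subset fun s hs ↦ ?_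
  have key : ∀ ε > 0, ∃ t ∈ sectionAlgebra n E, ∀ x, ‖s x - t x‖ < ε := fun ε hε ↦ by
    obtain ⟨t, ht, hst⟩ := Metric.mem_closure_iff.1 hs ε hε
    rw [dist_eq_norm] at hst
    exact ⟨t, ht, fun x ↦ (lp.norm_apply_le_norm ENNReal.top_ne_zero (s - t) x).trans_lt hst⟩
  refine ⟨IsContinuousSection.of_approx fun ε hε ↦ ?_, ?_⟩
  · obtain ⟨t, ht, hst⟩ := key ε hε
    exact ⟨t, ht.1, hst⟩
  · rw [Metric.tendsto_nhds]
    intro ε hε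
    obtain ⟨t, ht, hst⟩ := key (ε / 2) (half_pos hε)
    filter_upwards [Metric.tendsto_nhds.1 ht.2 (ε / 2) (half_pos hε)] with x hx
    simp only [dist_zero_right, norm_norm] at hx ⊢
    have := norm_add_le (s x - t x) (t x)
    rw [sub_add_cancel] at this
    linarith [hst x]

noncomputable instance sectionAlgebraCStarAlgebra : NonUnitalCStarAlgebra (sectionAlgebra n E) :=
  NonUnitalStarSubalgebra.nonUnitalCStarAlgebra (sectionAlgebra n E)

end Bundles

/-! ### Complex line subbundles -/

section LineSubbundles

variable {X : Type*} [TopologicalSpace X] (n : ℕ) {E : X → Type*} [∀ x, CStarAlgebra (E x)]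
  [TopologicalSpace (TotalSpace (Matrix (Fin n) (Fin n) ℂ) E)]

/-- The part over `S` of the total space of a family of subspaces `L x ⊆ E x`, with the topology
induced by the total space of `E`. -/
def restrictedTotalSpace (L : ∀ x, Submodule ℂ (E x)) (S : Set X) :
    Set (TotalSpace (Matrix (Fin n) (Fin n) ℂ) E) :=
  {p | p.proj ∈ S ∧ p.snd ∈ L p.proj}

/-- The family of subspaces `L x ⊆ E x` is a trivial complex line bundle over `S`: there is a
homeomorphism of `S × ℂ` onto `L|_S` that maps `{x} × ℂ` linearly to the fibre over `x`, for every
`x ∈ S`. -/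
def IsTrivialLineBundleOn (L : ∀ x, Submodule ℂ (E x)) (S : Set X) : Prop :=
  ∃ Φ : (S × ℂ) ≃ₜ restrictedTotalSpace n L S, ∀ x : S, ∃ ℓ : ℂ →ₗ[ℂ] E x, ∀ z : ℂ,
    (Φ (x, z) : TotalSpace (Matrix (Fin n) (Fin n) ℂ) E) = ⟨x, ℓ z⟩

/-- The family of subspaces `L x ⊆ E x`, `x ∈ U`, is a complex line subbundle of `E|_U`, that is,
a locally trivial complex line bundle over `U` (the values of `L` outside `U` play no role). -/
def IsLineSubbundleOn (L : ∀ x, Submodule ℂ (E x)) (U : Set X) : Prop :=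
  ∀ x ∈ U, ∃ V : Set X, IsOpen V ∧ x ∈ V ∧ IsTrivialLineBundleOn n L (V ∩ U)

/-- `L` is a phantom complex line subbundle of `E|_U`: a complex line subbundle that is not
globally trivial but is trivial on each compact subset of `U`. -/
def IsPhantomLineSubbundleOn (L : ∀ x, Submodule ℂ (E x)) (U : Set X) : Prop :=
  IsLineSubbundleOn n L U ∧ ¬ IsTrivialLineBundleOn n L U ∧
    ∀ K ⊆ U, IsCompact K → IsTrivialLineBundleOn n L K

end LineSubbundles

/-! On a matrix fibre `v ↦ a v b` has norm `‖a‖‖b‖` and determines the lines spanned by `a` and `b`,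
but not `a` and `b` themselves. The obstruction to closedness is choosing generators of these lines
continuously.

Let `φ` be a norm limit of multiplications by elements of `A`. In matrix units, two-sided
multiplications are the arrays of rank at most one, a closed condition, so `φ` acts on fibres as `v
↦ α x v β x` (`exists_fiberwise_mul_mul`). Here `α` and `β` may be discontinuous, but `N = ‖α‖‖β‖`
is a uniform limit of functions `‖a‖‖b‖` and so lies in `C₀(X)`; hence `U = {N ≠ 0}` is open and
σ-compact. The lines `ℂ α x` form a line subbundle over `U`. On a compact subset of `U`, projecting
a good approximant `a` onto these lines gives a frame, because a Hilbert-Schmidt orthogonal `a`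
would be far from `φ` (`isTrivialLineBundleOn_of_isCompact`). A frame over all of `U`, rescaled to
norm `√N`, would put `φ` in `TM₀(A)` (`exists_sections_of_isLineFrameOn`). So if `φ` is not in
`TM₀(A)`, the subbundle is phantom.

Conversely, given a phantom `L`, take `f ∈ C₀(X)` nonzero exactly on `U` and unit vectors `α x ∈ L
x`. The operator `v ↦ f α v α*` ignores the phase of `α`, hence preserves continuous sections.
Truncating `f` to a compact set approximates it within `TM₀(A)`
(`mem_closure_of_trivial_on_compacts`). It is not even in `TM(A)`: compressing by `f · 1` would turn
the left multiplier into a global frame of `L` (`notMem_twoSidedMul_of_not_trivial`). This one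
operator gives both the converse and the claim about `TM(A)`. -/

/-! ### Norm estimates for `v ↦ a v b` on a Hilbert space -/

section Operators

variable {H : Type*} [NormedAddCommGroup H] [InnerProductSpace ℂ H] [CompleteSpace H]

open InnerProductSpace in
lemma ContinuousLinearMap.mul_rankOne_mul (a b : H →L[ℂ] H) (x y : H) :
    a * rankOne ℂ x y * b = rankOne ℂ (a x) (adjoint b y) := by
  ext z
  simp [ContinuousLinearMap.adjoint_inner_left]

open InnerProductSpace in
/-- The norm of the operator `v ↦ a v b` on `B(H)` is at least `‖a‖ ‖b‖`. -/
lemma ContinuousLinearMap.norm_mul_norm_le_of_forall_mul_mul {a b : H →L[ℂ] H} {C : ℝ} (hC : 0 ≤ C)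
    (h : ∀ v, ‖a * v * b‖ ≤ C * ‖v‖) : ‖a‖ * ‖b‖ ≤ C := by
  -- Rank-one operators suffice as test elements; the suprema over `x` and then `y` are taken
  -- separately.
  have key (x y : H) : ‖a x‖ * ‖adjoint b y‖ ≤ C * (‖x‖ * ‖y‖) := by
    simpa [mul_rankOne_mul] using h (rankOne ℂ x y)
  have key' (y : H) : ‖adjoint b y‖ * ‖a‖ ≤ C * ‖y‖ := by
    rw [← norm_smul_of_nonneg (norm_nonneg _) a]
    refine ContinuousLinearMap.opNorm_le_bound _ (by positivity) fun x ↦ ?_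
    rw [smul_apply, norm_smul_of_nonneg (norm_nonneg _)]
    linarith [key x y]
  rw [← LinearIsometryEquiv.norm_map adjoint b, ← norm_smul_of_nonneg (norm_nonneg _)]
  refine ContinuousLinearMap.opNorm_le_bound _ hC fun y ↦ ?_
  rw [smul_apply, norm_smul_of_nonneg (norm_nonneg _)]
  linarith [key' y]

open InnerProductSpace in
/-- If `a` and `a'` are orthogonal for the Hilbert-Schmidt inner product, then the operators
`v ↦ a v b` and `v ↦ a' v b'` are far apart. -/
lemma ContinuousLinearMap.norm_mul_norm_le_of_orthogonal {ι : Type*} [Fintype ι]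
    (e : OrthonormalBasis ι ℂ H) {a b a' b' : H →L[ℂ] H} {ε : ℝ} (hε : 0 ≤ ε)
    (h : ∀ v, ‖a * v * b - a' * v * b'‖ ≤ ε * ‖v‖) (horth : ∑ j, inner ℂ (a (e j)) (a' (e j)) = 0) :
    ‖a‖ * ‖b‖ ≤ (Fintype.card ι : ℝ) ^ 2 * ε := by
  -- `S` dominates `‖a‖` and, by Cauchy-Schwarz, is controlled by the squared Hilbert-Schmidt norm
  -- `∑ ‖a (e j)‖²`.
  set S : ℝ := ∑ j, ‖a (e j)‖ with hS
  have hS0 : 0 ≤ S := Finset.sum_nonneg fun _ _ ↦ norm_nonneg _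
  have haS : ‖a‖ ≤ S := by
    refine ContinuousLinearMap.opNorm_le_bound _ hS0 fun x ↦ ?_
    conv_lhs => rw [← e.sum_repr x, map_sum]
    rw [hS, Finset.sum_mul]
    refine (norm_sum_le _ _).trans (Finset.sum_le_sum fun j _ ↦ ?_)
    rw [map_smul, norm_smul, mul_comm]
    gcongr
    rw [← e.repr.norm_map x]
    exact PiLp.norm_apply_le _ j
  have hSq : S ^ 2 ≤ Fintype.card ι * ∑ j, ‖a (e j)‖ ^ 2 := by
    simpa using sq_sum_le_card_mul_sum_sq (s := Finset.univ) (f := fun j ↦ ‖a (e j)‖)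
  -- Apply the difference to the rank-one operator of `e j` and `y`, evaluate at `z = b* y` and pair
  -- with `a (e j)`. Summing over `j` removes the primed term by orthogonality and leaves `‖z‖² ∑ ‖a
  -- (e j)‖²`.
  have key (y : H) : ‖adjoint b y‖ * ∑ j, ‖a (e j)‖ ^ 2 ≤ ε * ‖y‖ * S := by
    set z := adjoint b y
    rcases eq_or_ne z 0 with hz | hz
    · rw [hz, norm_zero, zero_mul]; positivity
    have h1 (j : ι) : ‖inner ℂ z z * inner ℂ (a (e j)) (a (e j)) -
        inner ℂ (adjoint b' y) z * inner ℂ (a (e j)) (a' (e j))‖ ≤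
        ε * ‖y‖ * ‖z‖ * ‖a (e j)‖ := by
      have h2 := (a * rankOne ℂ (e j) y * b - a' * rankOne ℂ (e j) y * b').le_of_opNorm_le
        (h _) z
      rw [mul_rankOne_mul, mul_rankOne_mul] at h2
      have h3 := norm_inner_le_norm (𝕜 := ℂ) (a (e j)) ((rankOne ℂ (a (e j)) z -
        rankOne ℂ (a' (e j)) (adjoint b' y)) z)
      simp only [sub_apply, rankOne_apply, inner_sub_right,
        inner_smul_right, norm_rankOne, e.norm_eq_one, one_mul] at h2 h3
      refine h3.trans ?_
      calc _ ≤ ‖a (e j)‖ * (ε * ‖y‖ * ‖z‖) := by gcongr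
        _ = _ := by ring
    have h4 : ‖∑ j, (inner ℂ z z * inner ℂ (a (e j)) (a (e j)) -
        inner ℂ (adjoint b' y) z * inner ℂ (a (e j)) (a' (e j)))‖ ≤ ε * ‖y‖ * ‖z‖ * S := by
      rw [hS, Finset.mul_sum]
      exact (norm_sum_le _ _).trans (Finset.sum_le_sum fun j _ ↦ h1 j)
    rw [Finset.sum_sub_distrib, ← Finset.mul_sum, ← Finset.mul_sum, horth, mul_zero, sub_zero,
      norm_mul] at h4
    simp only [inner_self_eq_norm_sq_to_K] at h4
    have h5 : ‖∑ j, ((‖a (e j)‖ : ℂ)) ^ 2‖ = ∑ j, ‖a (e j)‖ ^ 2 := by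
      rw [← Complex.norm_of_nonneg (Finset.sum_nonneg fun j _ ↦ sq_nonneg ‖a (e j)‖)]
      push_cast; rfl
    have h6 : ‖((‖z‖ : ℝ) : ℂ) ^ 2‖ = ‖z‖ ^ 2 := by simp
    erw [h5, h6] at h4
    have hz' : 0 < ‖z‖ := norm_pos_iff.2 hz
    nlinarith
  rcases hS0.eq_or_lt with h0 | hpos
  · have : ‖a‖ = 0 := le_antisymm (h0 ▸ haS) (norm_nonneg _)
    rw [this, zero_mul]; positivity
  have hb : S * ‖b‖ ≤ Fintype.card ι * ε := by
    rw [← LinearIsometryEquiv.norm_map adjoint b, ← norm_smul_of_nonneg hS0]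
    refine ContinuousLinearMap.opNorm_le_bound _ (by positivity) fun y ↦ ?_
    rw [smul_apply, norm_smul_of_nonneg hS0]
    refine le_of_mul_le_mul_left ?_ hpos
    calc S * (S * ‖adjoint b y‖) = S ^ 2 * ‖adjoint b y‖ := by ring
      _ ≤ (Fintype.card ι * ∑ j, ‖a (e j)‖ ^ 2) * ‖adjoint b y‖ := by gcongr
      _ = Fintype.card ι * (‖adjoint b y‖ * ∑ j, ‖a (e j)‖ ^ 2) := by ring
      _ ≤ Fintype.card ι * (ε * ‖y‖ * S) := mul_le_mul_of_nonneg_left (key y) (by positivity)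
      _ = _ := by ring
  -- The factor `card ι` already suffices; its square in the statement is slack.
  have hcard : (1 : ℝ) ≤ Fintype.card ι := by
    by_contra hlt
    have : Fintype.card ι = 0 := by
      by_contra h; exact hlt (by exact_mod_cast Nat.one_le_iff_ne_zero.2 h)
    have := Fintype.card_eq_zero_iff.1 this
    simp [hS] at hpos
  calc ‖a‖ * ‖b‖ ≤ S * ‖b‖ := by gcongr
    _ ≤ Fintype.card ι * ε := hb
    _ ≤ (Fintype.card ι : ℝ) ^ 2 * ε := by gcongr; nlinarith

end Operators

/-! ### Two-sided multiplications on matrices -/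

section Matrices

variable {n : ℕ}

lemma Matrix.mul_single_mul_apply (a b : Matrix (Fin n) (Fin n) ℂ) (p i k q : Fin n) :
    (a * Matrix.single i k (1 : ℂ) * b) p q = a p i * b k q := by
  simp [Matrix.mul_apply, Matrix.single_apply, ite_and]

/-- A pointwise limit of two-sided multiplications on `𝕄ₙ` is a two-sided multiplication. -/
lemma Matrix.exists_mul_mul_of_tendsto {T : Matrix (Fin n) (Fin n) ℂ → Matrix (Fin n) (Fin n) ℂ}
    {a b : ℕ → Matrix (Fin n) (Fin n) ℂ} (h : ∀ m, Tendsto (fun k ↦ a k * m * b k) atTop (𝓝 (T m))) :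
    ∃ a b, ∀ m, T m = a * m * b := by
  have hent (m p q) : Tendsto (fun k ↦ (a k * m * b k) p q) atTop (𝓝 (T m p q)) :=
    tendsto_pi_nhds.1 (tendsto_pi_nhds.1 (h m) p) q
  have hexp (m p q) : T m p q = ∑ i, ∑ k, m i k * T (Matrix.single i k (1 : ℂ)) p q := by
    refine tendsto_nhds_unique (hent m p q) ?_
    have : Tendsto (fun j ↦ ∑ i, ∑ k, m i k * (a j * Matrix.single i k (1 : ℂ) * b j) p q) atTop
        (𝓝 (∑ i, ∑ k, m i k * T (Matrix.single i k (1 : ℂ)) p q)) :=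
      tendsto_finsetSum _ fun i _ ↦ tendsto_finsetSum _ fun k _ ↦ (hent _ p q).const_mul _
    refine this.congr fun j ↦ ?_
    simp only [mul_single_mul_apply, Matrix.mul_assoc]
    simp only [Matrix.mul_apply, Finset.mul_sum]
    refine Finset.sum_congr rfl fun i _ ↦ Finset.sum_congr rfl fun k _ ↦ by ring
  -- The array with rows `(p, i)` and columns `(k, q)` is `a p i * b k q` for each approximant. Its
  -- 2 × 2 minors vanish, and this passes to the limit although `a k` and `b k` need not converge.
  have hrank (p i k q p' i' k' q') : T (Matrix.single i k (1 : ℂ)) p q * T (Matrix.single i' k' (1 : ℂ)) p' q' =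
      T (Matrix.single i k' (1 : ℂ)) p q' * T (Matrix.single i' k (1 : ℂ)) p' q := by
    refine tendsto_nhds_unique ((hent _ p q).mul (hent _ p' q')) ?_
    refine ((hent _ p q').mul (hent _ p' q)).congr fun j ↦ ?_
    simp only [mul_single_mul_apply]
    ring
  by_cases h0 : ∃ p i k q, T (Matrix.single i k (1 : ℂ)) p q ≠ 0
  · obtain ⟨p', i', k', q', h0⟩ := h0
    -- A rank-one array is the product of the column and the row through a nonzero entry, divided by
    -- that entry.
    refine ⟨.of fun p i ↦ T (Matrix.single i k' (1 : ℂ)) p q',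
      .of fun k q ↦ T (Matrix.single i' k (1 : ℂ)) p' q / T (Matrix.single i' k' (1 : ℂ)) p' q', fun m ↦ ?_⟩
    ext p q
    rw [hexp, Matrix.mul_assoc]
    simp only [Matrix.mul_apply, Finset.mul_sum, Matrix.of_apply]
    refine Finset.sum_congr rfl fun i _ ↦ Finset.sum_congr rfl fun k _ ↦ ?_
    have := hrank p i k q p' i' k' q'
    field_simp
    linear_combination m i k * this
  · push Not at h0
    refine ⟨0, 0, fun m ↦ ?_⟩
    ext p q
    simp [hexp m p q, h0]

open scoped Matrix.Norms.L2Operator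

lemma Matrix.norm_mul_norm_le_of_forall_mul_mul {a b : Matrix (Fin n) (Fin n) ℂ} {C : ℝ}
    (hC : 0 ≤ C) (h : ∀ m : Matrix (Fin n) (Fin n) ℂ, ‖a * m * b‖ ≤ C * ‖m‖) : ‖a‖ * ‖b‖ ≤ C := by
  let F := Matrix.toEuclideanCLM (n := Fin n) (𝕜 := ℂ)
  refine ContinuousLinearMap.norm_mul_norm_le_of_forall_mul_mul (a := F a) (b := F b) hC fun v ↦ ?_
  obtain ⟨m, rfl⟩ : ∃ m, F m = v := F.surjective v
  rw [← map_mul, ← map_mul]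
  exact h m

/-- `trace (a* a')` is the Hilbert-Schmidt inner product, which makes sense in the fibres of the
bundle. -/
lemma Matrix.norm_mul_norm_le_of_trace_eq_zero {a b a' b' : Matrix (Fin n) (Fin n) ℂ} {ε : ℝ}
    (hε : 0 ≤ ε)
    (h : ∀ m : Matrix (Fin n) (Fin n) ℂ, ‖a * m * b - a' * m * b'‖ ≤ ε * ‖m‖)
    (htr : (star a * a').trace = 0) : ‖a‖ * ‖b‖ ≤ (n : ℝ) ^ 2 * ε := by
  let F := Matrix.toEuclideanCLM (n := Fin n) (𝕜 := ℂ)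
  have := ContinuousLinearMap.norm_mul_norm_le_of_orthogonal (EuclideanSpace.basisFun (Fin n) ℂ)
    (a := F a) (b := F b) (a' := F a') (b' := F b') hε (fun v ↦ ?_) ?_
  · rw [Fintype.card_fin] at this
    exact this
  · obtain ⟨m, rfl⟩ : ∃ m, F m = v := F.surjective v
    rw [← map_mul, ← map_mul, ← map_mul, ← map_mul, ← map_sub]
    exact h m
  · rw [← htr]
    simp only [Matrix.trace, Matrix.diag, Matrix.mul_apply, PiLp.inner_apply]
    refine Finset.sum_congr rfl fun j _ ↦ Finset.sum_congr rfl fun i _ ↦ ?_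
    simp [F, Matrix.star_apply, mul_comm]

end Matrices

/-! ### Continuous sections, the fibrewise trace and frames of line subbundles -/

section Sections

open scoped Matrix.Norms.L2Operator

variable {X : Type*} [TopologicalSpace X] {n : ℕ} {E : X → Type*}
  [TopologicalSpace (TotalSpace (Matrix (Fin n) (Fin n) ℂ) E)]

variable (n) in
/-- Continuity at `x`, within the set `S`, of a (set-theoretic) section of the bundle. -/
def SectionContinuousWithinAt (s : ∀ x, E x) (S : Set X) (x : X) : Prop :=
  ContinuousWithinAt (fun y ↦ (⟨y, s y⟩ : TotalSpace (Matrix (Fin n) (Fin n) ℂ) E)) S x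

lemma isContinuousSection_iff {s : ∀ x, E x} :
    IsContinuousSection n E s ↔ ∀ x, SectionContinuousWithinAt n s Set.univ x := by
  simp only [IsContinuousSection, SectionContinuousWithinAt, continuousWithinAt_univ,
    continuous_iff_continuousAt]

lemma SectionContinuousWithinAt.mono {s : ∀ x, E x} {S T : Set X} {x : X}
    (h : SectionContinuousWithinAt n s S x) (hT : T ⊆ S) : SectionContinuousWithinAt n s T x :=
  ContinuousWithinAt.mono h hT

lemma SectionContinuousWithinAt.mono_of_mem_nhdsWithin {s : ∀ x, E x} {S T : Set X} {x : X}
    (h : SectionContinuousWithinAt n s T x) (hT : T ∈ 𝓝[S] x) :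
    SectionContinuousWithinAt n s S x :=
  ContinuousWithinAt.mono_of_mem_nhdsWithin h hT

lemma SectionContinuousWithinAt.congr_of_eventuallyEq {s t : ∀ x, E x} {S : Set X} {x : X}
    (h : SectionContinuousWithinAt n s S x) (hst : ∀ᶠ y in 𝓝[S] x, t y = s y) (hx : t x = s x) :
    SectionContinuousWithinAt n t S x :=
  ContinuousWithinAt.congr_of_eventuallyEq h (hst.mono fun y hy ↦ by simp only [hy])
    (by simp only [hx])

lemma sectionContinuousWithinAt_iff
    (e : Trivialization (Matrix (Fin n) (Fin n) ℂ) (π (Matrix (Fin n) (Fin n) ℂ) E))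
    {s : ∀ x, E x} {S : Set X} {x : X} (hx : x ∈ e.baseSet) :
    SectionContinuousWithinAt n s S x ↔ ContinuousWithinAt (fun y ↦ (e ⟨y, s y⟩).2) S x := by
  unfold SectionContinuousWithinAt ContinuousWithinAt
  rw [e.tendsto_nhds_iff (by rw [e.mem_source]; exact hx)]
  exact ⟨fun h ↦ h.2, fun h ↦ ⟨tendsto_id.mono_left nhdsWithin_le_nhds, h⟩⟩

variable [∀ x, CStarAlgebra (E x)]

/-- A local trivialization that is a *-isomorphism on each fibre. -/
def IsStarTrivialization
    (e : Trivialization (Matrix (Fin n) (Fin n) ℂ) (π (Matrix (Fin n) (Fin n) ℂ) E)) : Prop :=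
  ∀ y ∈ e.baseSet, ∃ ψ : E y ≃⋆ₐ[ℂ] Matrix (Fin n) (Fin n) ℂ, ∀ v : E y, e ⟨y, v⟩ = (y, ψ v)

variable [IsMatrixBundle n E]

variable (n E) in
lemma exists_isStarTrivialization (x : X) :
    ∃ e : Trivialization (Matrix (Fin n) (Fin n) ℂ) (π (Matrix (Fin n) (Fin n) ℂ) E),
      x ∈ e.baseSet ∧ IsStarTrivialization e :=
  IsMatrixBundle.exists_trivialization x

variable (n E) in
lemma exists_fiberEquiv (x : X) : Nonempty (E x ≃⋆ₐ[ℂ] Matrix (Fin n) (Fin n) ℂ) := by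
  obtain ⟨e, hx, he⟩ := exists_isStarTrivialization n E x
  exact ⟨(he x hx).choose⟩

variable (n) in
/-- The trace on the fibre `E x`, computed through any *-isomorphism with `𝕄ₙ`. -/
noncomputable def fiberTrace {x : X} (v : E x) : ℂ := ((exists_fiberEquiv n E x).some v).trace

/-- Two isomorphisms with `𝕄ₙ` differ by an automorphism of `𝕄ₙ`, which preserves the trace. -/
lemma fiberTrace_eq {x : X} (ψ : E x ≃⋆ₐ[ℂ] Matrix (Fin n) (Fin n) ℂ) (v : E x) :
    fiberTrace n v = (ψ v).trace := by
  let ψ' := (exists_fiberEquiv n E x).some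
  have := Matrix.trace_map (ψ'.symm.trans ψ).toAlgEquiv (ψ' v)
  change (ψ (ψ'.symm (ψ' v))).trace = _ at this
  rw [ψ'.symm_apply_apply] at this
  exact this.symm

lemma fiberTrace_smul {x : X} (c : ℂ) (v : E x) : fiberTrace n (c • v) = c * fiberTrace n v := by
  simp [fiberTrace]

open scoped ComplexOrder in
lemma fiberTrace_star_mul_self_eq_zero {x : X} {v : E x} :
    fiberTrace n (star v * v) = 0 ↔ v = 0 := by
  simp only [fiberTrace, map_mul, map_star, Matrix.star_eq_conjTranspose,
    Matrix.trace_conjTranspose_mul_self_eq_zero_iff]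
  exact map_eq_zero_iff _ (exists_fiberEquiv n E x).some.injective

namespace SectionContinuousWithinAt

lemma map₂ (f : ∀ x, E x → E x → E x)
    (g : Matrix (Fin n) (Fin n) ℂ → Matrix (Fin n) (Fin n) ℂ → Matrix (Fin n) (Fin n) ℂ)
    (hg : Continuous fun p : Matrix (Fin n) (Fin n) ℂ × Matrix (Fin n) (Fin n) ℂ ↦ g p.1 p.2)
    (hfg : ∀ x (ψ : E x ≃⋆ₐ[ℂ] Matrix (Fin n) (Fin n) ℂ) v w, ψ (f x v w) = g (ψ v) (ψ w))
    {s t : ∀ x, E x} {S : Set X} {x : X} (hs : SectionContinuousWithinAt n s S x)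
    (ht : SectionContinuousWithinAt n t S x) :
    SectionContinuousWithinAt n (fun x ↦ f x (s x) (t x)) S x := by
  obtain ⟨e, hx, he⟩ := exists_isStarTrivialization n E x
  have hfe (y) (hy : y ∈ e.baseSet) :
      (e ⟨y, f y (s y) (t y)⟩).2 = g (e ⟨y, s y⟩).2 (e ⟨y, t y⟩).2 := by
    obtain ⟨ψ, hψ⟩ := he y hy
    simp [hψ, hfg]
  rw [sectionContinuousWithinAt_iff e hx] at hs ht ⊢
  refine (hg.continuousAt.comp_continuousWithinAt (hs.prodMk ht)).congr_of_eventuallyEq ?_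
    (hfe x hx)
  filter_upwards [mem_nhdsWithin_of_mem_nhds (e.open_baseSet.mem_nhds hx)] with y hy
  exact hfe y hy

variable {s t : ∀ x, E x} {S : Set X} {x : X}

lemma mul (hs : SectionContinuousWithinAt n s S x) (ht : SectionContinuousWithinAt n t S x) :
    SectionContinuousWithinAt n (fun x ↦ s x * t x) S x :=
  hs.map₂ (fun _ v w ↦ v * w) (fun v w ↦ v * w) continuous_mul (fun _ ψ v w ↦ map_mul ψ v w) ht

lemma star (hs : SectionContinuousWithinAt n s S x) :
    SectionContinuousWithinAt n (fun x ↦ star (s x)) S x :=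
  hs.map₂ (fun _ v _ ↦ Star.star v) (fun v _ ↦ Star.star v) (by fun_prop)
    (fun _ ψ v _ ↦ map_star ψ v) hs

lemma smul {c : X → ℂ} (hc : ContinuousWithinAt c S x) (hs : SectionContinuousWithinAt n s S x) :
    SectionContinuousWithinAt n (fun x ↦ c x • s x) S x := by
  obtain ⟨e, hx, he⟩ := exists_isStarTrivialization n E x
  have hfe (y) (hy : y ∈ e.baseSet) : (e ⟨y, c y • s y⟩).2 = c y • (e ⟨y, s y⟩).2 := by
    obtain ⟨ψ, hψ⟩ := he y hy
    simp [hψ]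
  rw [sectionContinuousWithinAt_iff e hx] at hs ⊢
  refine (ContinuousWithinAt.smul hc hs).congr_of_eventuallyEq ?_ (hfe x hx)
  filter_upwards [mem_nhdsWithin_of_mem_nhds (e.open_baseSet.mem_nhds hx)] with y hy
  exact hfe y hy

lemma norm (hs : SectionContinuousWithinAt n s S x) :
    ContinuousWithinAt (fun x ↦ ‖s x‖) S x := by
  obtain ⟨e, hx, he⟩ := exists_isStarTrivialization n E x
  have hfe (y) (hy : y ∈ e.baseSet) : ‖s y‖ = ‖(e ⟨y, s y⟩).2‖ := by
    obtain ⟨ψ, hψ⟩ := he y hy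
    simp only [hψ]
    exact (StarAlgEquiv.norm_map ψ _).symm
  rw [sectionContinuousWithinAt_iff e hx] at hs
  refine (ContinuousWithinAt.norm hs).congr_of_eventuallyEq ?_ (hfe x hx)
  filter_upwards [mem_nhdsWithin_of_mem_nhds (e.open_baseSet.mem_nhds hx)] with y hy
  exact hfe y hy

lemma fiberTrace (hs : SectionContinuousWithinAt n s S x) :
    ContinuousWithinAt (fun x ↦ fiberTrace n (s x)) S x := by
  obtain ⟨e, hx, he⟩ := exists_isStarTrivialization n E x
  have hfe (y) (hy : y ∈ e.baseSet) : _root_.fiberTrace n (s y) = (e ⟨y, s y⟩).2.trace := by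
    obtain ⟨ψ, hψ⟩ := he y hy
    simp only [hψ, fiberTrace_eq ψ]
  rw [sectionContinuousWithinAt_iff e hx] at hs
  have hc : Continuous fun m : Matrix (Fin n) (Fin n) ℂ ↦ m.trace := continuous_id.matrix_trace
  refine (hc.continuousAt.comp_continuousWithinAt hs).congr_of_eventuallyEq ?_ (hfe x hx)
  filter_upwards [mem_nhdsWithin_of_mem_nhds (e.open_baseSet.mem_nhds hx)] with y hy
  exact hfe y hy

/-- Trivializations are isometric on fibres, so at a zero continuity concerns norms only. This
handles sections extended by zero at the boundary of an open set. -/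
lemma of_norm (hx : s x = 0) (hs : Tendsto (fun x ↦ ‖s x‖) (𝓝[S] x) (𝓝 0)) :
    SectionContinuousWithinAt n s S x := by
  obtain ⟨e, hxe, he⟩ := exists_isStarTrivialization n E x
  have hfe (y) (hy : y ∈ e.baseSet) : ‖s y‖ = ‖(e ⟨y, s y⟩).2‖ := by
    obtain ⟨ψ, hψ⟩ := he y hy
    simp only [hψ]
    exact (StarAlgEquiv.norm_map ψ _).symm
  rw [sectionContinuousWithinAt_iff e hxe, ContinuousWithinAt]
  have h0 : (e ⟨x, s x⟩).2 = 0 := by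
    rw [← norm_eq_zero, ← hfe x hxe, hx, norm_zero]
  rw [h0, tendsto_zero_iff_norm_tendsto_zero]
  refine hs.congr' ?_
  filter_upwards [mem_nhdsWithin_of_mem_nhds (e.open_baseSet.mem_nhds hxe)] with y hy
  exact hfe y hy

end SectionContinuousWithinAt

lemma exists_mem_sectionAlgebra {s : ∀ x, E x} (hs : IsContinuousSection n E s)
    (h0 : Tendsto (fun x ↦ ‖s x‖) (cocompact X) (𝓝 0)) :
    ∃ t : sectionAlgebra n E, ∀ x, (t : lp E ∞) x = s x := by
  have hc : Continuous fun x ↦ ‖s x‖ := continuous_iff_continuousAt.2 fun x ↦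
    (continuousWithinAt_univ _ _).1 (isContinuousSection_iff.1 hs x).norm
  have hb := ZeroAtInftyContinuousMap.isBounded_range (⟨⟨_, hc⟩, h0⟩ : ZeroAtInftyContinuousMap X ℝ)
  exact ⟨⟨⟨s, memℓp_infty hb.bddAbove⟩, hs, h0⟩, fun _ ↦ rfl⟩

lemma sectionAlgebra.sectionContinuousWithinAt (s : sectionAlgebra n E) (S : Set X) (x : X) :
    SectionContinuousWithinAt n (s : lp E ∞) S x :=
  (isContinuousSection_iff.1 s.2.1 x).mono (Set.subset_univ _)

lemma sectionAlgebra.tendsto_norm (s : sectionAlgebra n E) :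
    Tendsto (fun x ↦ ‖(s : lp E ∞) x‖) (cocompact X) (𝓝 0) := s.2.2

lemma sectionAlgebra.norm_apply_le (s : sectionAlgebra n E) (x : X) : ‖(s : lp E ∞) x‖ ≤ ‖s‖ :=
  lp.norm_apply_le_norm ENNReal.top_ne_zero (s : lp E ∞) x

lemma sectionAlgebra.norm_le {s : sectionAlgebra n E} {C : ℝ} (hC : 0 ≤ C)
    (h : ∀ x, ‖(s : lp E ∞) x‖ ≤ C) : ‖s‖ ≤ C :=
  lp.norm_le_of_forall_le hC h

lemma sectionAlgebra.ext {s t : sectionAlgebra n E} (h : ∀ x, (s : lp E ∞) x = (t : lp E ∞) x) :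
    s = t :=
  Subtype.ext (lp.ext (funext h))

/-- Sections of `E` vanishing at infinity extend the local sections that are constant in a given
trivialization. -/
lemma exists_section_eventually_eq [T2Space X] [LocallyCompactSpace X]
    {e : Trivialization (Matrix (Fin n) (Fin n) ℂ) (π (Matrix (Fin n) (Fin n) ℂ) E)}
    (he : IsStarTrivialization e) {x : X} (hx : x ∈ e.baseSet) (m : Matrix (Fin n) (Fin n) ℂ) :
    ∃ s : sectionAlgebra n E, ‖s‖ ≤ ‖m‖ ∧ ∀ᶠ y in 𝓝 x, e ⟨y, (s : lp E ∞) y⟩ = (y, m) := by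
  obtain ⟨K, hK, hxK, hKe⟩ := exists_compact_subset e.open_baseSet hx
  -- The cutoff is supported in a closed set inside the base set, so the section vanishes near every
  -- point where `e.symm` carries no information.
  obtain ⟨K', hK', hK'c, hKK', hK'e⟩ : ∃ K', IsCompact K' ∧ IsClosed K' ∧ K ⊆ interior K' ∧
      K' ⊆ e.baseSet := exists_compact_closed_between hK e.open_baseSet hKe
  obtain ⟨f, hf1, hf0, -, hf⟩ := exists_continuous_one_zero_of_isCompact
    hK isOpen_interior.isClosed_compl (Set.disjoint_compl_right_iff_subset.2 hKK')
  have hsymm (y) (hy : y ∈ e.baseSet) : e ⟨y, (f y : ℂ) • e.symm y m⟩ = (y, (f y : ℂ) • m) := by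
    have := e.apply_mk_symm hy m
    obtain ⟨ψ, hψ⟩ := he y hy
    rw [hψ] at this ⊢
    rw [map_smul, (Prod.mk.inj this).2]
  have hf0' (y) (hy : y ∉ K') : f y = 0 := hf0 fun h ↦ hy (interior_subset h)
  have hnorm (y) : ‖(f y : ℂ) • e.symm y m‖ ≤ |f y| * ‖m‖ := by
    by_cases hy : y ∈ e.baseSet
    · have := hsymm y hy
      obtain ⟨ψ, hψ⟩ := he y hy
      rw [hψ] at this
      rw [← StarAlgEquiv.norm_map ψ, (Prod.mk.inj this).2, norm_smul, Complex.norm_real,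
        Real.norm_eq_abs]
    · rw [hf0' y fun h ↦ hy (hK'e h)]
      simp
  have hcont : IsContinuousSection n E fun y ↦ (f y : ℂ) • e.symm y m := by
    refine isContinuousSection_iff.2 fun y ↦ ?_
    by_cases hy : y ∈ e.baseSet
    · rw [sectionContinuousWithinAt_iff e hy]
      have : ContinuousWithinAt (fun y ↦ (f y : ℂ) • m) Set.univ y :=
        Continuous.continuousWithinAt (by fun_prop)
      refine this.congr_of_eventuallyEq ?_ (by rw [hsymm y hy])
      filter_upwards [mem_nhdsWithin_of_mem_nhds (e.open_baseSet.mem_nhds hy)] with z hz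
      rw [hsymm z hz]
    · have h0 : ∀ᶠ z in 𝓝[Set.univ] y, (f z : ℂ) • e.symm z m = 0 := by
        rw [nhdsWithin_univ]
        filter_upwards [hK'c.isOpen_compl.mem_nhds fun h ↦ hy (hK'e h)] with z hz
        rw [hf0' z hz]; simp
      exact .of_norm (by rw [hf0' y fun h ↦ hy (hK'e h)]; simp)
        (tendsto_const_nhds.congr' (h0.mono fun z hz ↦ by simp only [hz, norm_zero]))
  have hlim : Tendsto (fun y ↦ ‖(f y : ℂ) • e.symm y m‖) (cocompact X) (𝓝 0) := by
    refine tendsto_const_nhds.congr' ?_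
    filter_upwards [hK'.compl_mem_cocompact] with z hz
    rw [hf0' z hz]; simp
  obtain ⟨s, hs⟩ := exists_mem_sectionAlgebra hcont hlim
  refine ⟨s, sectionAlgebra.norm_le (norm_nonneg _) fun y ↦ ?_, ?_⟩
  · rw [hs]
    refine (hnorm y).trans (mul_le_of_le_one_left (norm_nonneg _) ?_)
    rw [abs_of_nonneg (hf y).1]
    exact (hf y).2
  · filter_upwards [mem_interior_iff_mem_nhds.1 hxK] with y hy
    rw [hs, hsymm y (hKe hy), hf1 hy]
    simp

/-- Lifting without increase of norm lets operator norm bounds on `A` descend to each fibre with the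
same constant. -/
lemma exists_section_apply_eq [T2Space X] [LocallyCompactSpace X] {x : X} (v : E x) :
    ∃ s : sectionAlgebra n E, ‖s‖ ≤ ‖v‖ ∧ (s : lp E ∞) x = v := by
  obtain ⟨e, hx, he⟩ := exists_isStarTrivialization n E x
  obtain ⟨s, hs, hse⟩ := exists_section_eventually_eq he hx (e ⟨x, v⟩).2
  have hsx := hse.self_of_nhds
  obtain ⟨ψ, hψ⟩ := he x hx
  simp only [hψ] at hs hsx
  refine ⟨s, hs.trans_eq (StarAlgEquiv.norm_map ψ v), ψ.injective (Prod.mk.inj hsx).2⟩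

/-- `s` is a nowhere vanishing continuous section over `S` that spans the family `L`. -/
def IsLineFrameOn (n : ℕ) [TopologicalSpace (TotalSpace (Matrix (Fin n) (Fin n) ℂ) E)]
    (L : ∀ x, Submodule ℂ (E x)) (s : ∀ x, E x) (S : Set X) : Prop :=
  ∀ x ∈ S, SectionContinuousWithinAt n s S x ∧ s x ≠ 0 ∧ L x = ℂ ∙ s x

omit [IsMatrixBundle n E] in
lemma IsLineFrameOn.mono {L : ∀ x, Submodule ℂ (E x)} {s : ∀ x, E x} {S T : Set X}
    (h : IsLineFrameOn n L s S) (hT : T ⊆ S) : IsLineFrameOn n L s T :=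
  fun x hx ↦ ⟨(h x (hT hx)).1.mono hT, (h x (hT hx)).2⟩

omit [IsMatrixBundle n E] in
lemma IsTrivialLineBundleOn.exists_isLineFrameOn {L : ∀ x, Submodule ℂ (E x)} {S : Set X}
    (h : IsTrivialLineBundleOn n L S) : ∃ s, IsLineFrameOn n L s S := by
  classical
  obtain ⟨Φ, hΦ⟩ := h
  choose ℓ hℓ using hΦ
  let s : ∀ x, E x := fun x ↦ if hx : x ∈ S then ℓ ⟨x, hx⟩ 1 else 0
  have hs (x : S) (z : ℂ) :
      (Φ (x, z) : TotalSpace (Matrix (Fin n) (Fin n) ℂ) E) = ⟨x, z • s x⟩ := by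
    rw [hℓ]
    simp only [s, x.2, dif_pos, ← map_smul, smul_eq_mul, mul_one]
  refine ⟨s, fun x hx ↦ ⟨?_, ?_, ?_⟩⟩
  · have hcont : ContinuousOn (fun y ↦ (⟨y, s y⟩ : TotalSpace (Matrix (Fin n) (Fin n) ℂ) E)) S := by
      rw [continuousOn_iff_continuous_domRestrict]
      have : Continuous fun y : S ↦
          (Φ (y, 1) : TotalSpace (Matrix (Fin n) (Fin n) ℂ) E) := by fun_prop
      refine this.congr fun y ↦ ?_
      rw [hs, one_smul]; rfl
    exact hcont x hx
  · intro h0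
    have h1 : (Φ (⟨x, hx⟩, 0) : TotalSpace (Matrix (Fin n) (Fin n) ℂ) E) = Φ (⟨x, hx⟩, 1) := by
      rw [hs, hs, h0, smul_zero, smul_zero]
    have := Φ.injective (Subtype.ext h1)
    simp at this
  · ext v
    rw [Submodule.mem_span_singleton]
    constructor
    · intro hv
      obtain ⟨⟨y, z⟩, hyz⟩ := Φ.surjective ⟨⟨x, v⟩, hx, hv⟩
      have h1 := hs y z
      rw [hyz] at h1
      obtain ⟨y, hy⟩ := y
      obtain rfl : x = y := congrArg TotalSpace.proj h1
      exact ⟨z, (TotalSpace.mk_inj.1 h1).symm⟩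
    · rintro ⟨z, rfl⟩
      have := (Φ (⟨x, hx⟩, z)).2
      rw [hs] at this
      exact this.2

/-- The inverse of `(x, z) ↦ z • s x` is the Hilbert-Schmidt coefficient `tr (s* v) / tr (s* s)`,
which is continuous. -/
lemma IsLineFrameOn.isTrivialLineBundleOn {L : ∀ x, Submodule ℂ (E x)} {s : ∀ x, E x} {S : Set X}
    (h : IsLineFrameOn n L s S) : IsTrivialLineBundleOn n L S := by
  let coord : ∀ p : TotalSpace (Matrix (Fin n) (Fin n) ℂ) E, ℂ := fun p ↦
    fiberTrace n (star (s p.proj) * p.snd) / fiberTrace n (star (s p.proj) * s p.proj)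
  have hcoord (x) (hx : x ∈ S) (z : ℂ) : coord ⟨x, z • s x⟩ = z := by
    have : fiberTrace n (star (s x) * s x) ≠ 0 :=
      fun h0 ↦ (h x hx).2.1 (fiberTrace_star_mul_self_eq_zero.1 h0)
    simp only [coord, mul_smul_comm, fiberTrace_smul]
    field_simp
  let Φ : (S × ℂ) ≃ restrictedTotalSpace n L S :=
    { toFun := fun p ↦ ⟨⟨p.1, p.2 • s p.1⟩, p.1.2, by
        rw [(h _ p.1.2).2.2]; exact Submodule.mem_span_singleton.2 ⟨_, rfl⟩⟩
      invFun := fun p ↦ (⟨p.1.proj, p.2.1⟩, coord p.1)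
      left_inv := fun p ↦ by
        ext1
        · rfl
        · exact hcoord p.1 p.1.2 p.2
      right_inv := fun ⟨⟨x, v⟩, hx, hv⟩ ↦ by
        dsimp only at hx hv
        rw [(h x hx).2.2, Submodule.mem_span_singleton] at hv
        obtain ⟨z, rfl⟩ := hv
        refine Subtype.ext ?_
        dsimp only
        rw [hcoord x hx z] }
  refine ⟨⟨Φ, ?_, ?_⟩, fun x ↦ ⟨LinearMap.toSpanSingleton ℂ _ (s x), fun z ↦ rfl⟩⟩
  · refine continuous_iff_continuousAt.2 fun ⟨⟨x, hx⟩, z⟩ ↦ ?_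
    obtain ⟨e, hxe, he⟩ := exists_isStarTrivialization n E x
    have hs := (sectionContinuousWithinAt_iff e hxe).1 (h x hx).1
    have hval : Tendsto (fun p : S × ℂ ↦ (p.1 : X)) (𝓝 (⟨x, hx⟩, z)) (𝓝[S] x) :=
      tendsto_nhdsWithin_iff.2 ⟨(continuous_subtype_val.comp continuous_fst).continuousAt,
        .of_forall fun p ↦ p.1.2⟩
    have hsmul (y) (hy : y ∈ e.baseSet) (w : ℂ) :
        (e ⟨y, w • s y⟩).2 = w • (e ⟨y, s y⟩).2 := by
      obtain ⟨ψ, hψ⟩ := he y hy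
      simp [hψ]
    rw [Topology.IsInducing.subtypeVal.continuousAt_iff, ContinuousAt]
    refine (e.tendsto_nhds_iff (by rw [e.mem_source]; exact hxe)).2
      ⟨hval.mono_right nhdsWithin_le_nhds, ?_⟩
    have := (continuous_snd (X := S)).tendsto (⟨x, hx⟩, z) |>.smul (hs.tendsto.comp hval)
    simp only [Function.comp_apply]
    change Tendsto _ _ (𝓝 ((e ⟨x, z • s x⟩).2))
    rw [hsmul x hxe]
    refine this.congr' ?_
    filter_upwards [(hval.mono_right nhdsWithin_le_nhds).eventually
      (e.open_baseSet.mem_nhds hxe)] with p hp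
    exact (hsmul p.1 hp p.2).symm
  · refine continuous_iff_continuousAt.2 fun ⟨⟨x, v⟩, hx, hv⟩ ↦ ?_
    dsimp only at hx hv
    obtain ⟨e, hxe, he⟩ := exists_isStarTrivialization n E x
    have hs := (sectionContinuousWithinAt_iff e hxe).1 (h x hx).1
    have hsrc : (⟨x, v⟩ : TotalSpace (Matrix (Fin n) (Fin n) ℂ) E) ∈ e.source := by
      rw [e.mem_source]; exact hxe
    have hproj : ContinuousAt (fun p : restrictedTotalSpace n L S ↦ p.1.proj)
        ⟨⟨x, v⟩, hx, hv⟩ :=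
      (e.continuousAt_proj hsrc).comp_of_eq continuous_subtype_val.continuousAt rfl
    have hval : Tendsto (fun p : restrictedTotalSpace n L S ↦ p.1.proj) (𝓝 ⟨⟨x, v⟩, hx, hv⟩)
        (𝓝[S] x) := tendsto_nhdsWithin_iff.2 ⟨hproj, .of_forall fun p ↦ p.2.1⟩
    have he2 : ContinuousAt (fun p : restrictedTotalSpace n L S ↦ (e p.1).2)
        ⟨⟨x, v⟩, hx, hv⟩ :=
      ((e.continuousAt hsrc).comp_of_eq continuous_subtype_val.continuousAt rfl).snd
    refine ContinuousAt.prodMk ?_ ?_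
    · rw [Topology.IsInducing.subtypeVal.continuousAt_iff]
      exact hproj
    have htr : Continuous fun m : Matrix (Fin n) (Fin n) ℂ ↦ m.trace := continuous_id.matrix_trace
    have hm := hs.tendsto.comp hval
    have heq (p : TotalSpace (Matrix (Fin n) (Fin n) ℂ) E) (hp : p.proj ∈ e.baseSet) :
        coord p = (star (e ⟨p.proj, s p.proj⟩).2 * (e p).2).trace /
          (star (e ⟨p.proj, s p.proj⟩).2 * (e ⟨p.proj, s p.proj⟩).2).trace := by
      obtain ⟨y, w⟩ := p
      obtain ⟨ψ, hψ⟩ := he y hp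
      simp only [coord, hψ, fiberTrace_eq ψ, map_mul, map_star]
    have h0 : (star (e ⟨x, s x⟩).2 * (e ⟨x, s x⟩).2).trace ≠ 0 := by
      obtain ⟨ψ, hψ⟩ := he x hxe
      have : fiberTrace n (star (s x) * s x) ≠ 0 :=
        fun h0 ↦ (h x hx).2.1 (fiberTrace_star_mul_self_eq_zero.1 h0)
      simpa only [hψ, fiberTrace_eq ψ, map_mul, map_star] using this
    have hnum : Tendsto _ _ _ := (htr.tendsto _).comp (hm.star.mul he2.tendsto)
    have hden : Tendsto _ _ _ := (htr.tendsto _).comp (hm.star.mul hm)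
    have hdiv := hnum.div hden h0
    change Tendsto (fun p : restrictedTotalSpace n L S ↦ coord p.1) _ (𝓝 (coord ⟨x, v⟩))
    rw [heq _ hxe]
    refine hdiv.congr' ?_
    filter_upwards [hproj.eventually (e.open_baseSet.mem_nhds hxe)] with p hp
    exact (heq p.1 hp).symm

lemma isTrivialLineBundleOn_iff {L : ∀ x, Submodule ℂ (E x)} {S : Set X} :
    IsTrivialLineBundleOn n L S ↔ ∃ s, IsLineFrameOn n L s S :=
  ⟨fun h ↦ h.exists_isLineFrameOn, fun ⟨_, hs⟩ ↦ hs.isTrivialLineBundleOn⟩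

end Sections

/-! ### Transfer of the matrix estimates to a fibre -/

section Fibers

open scoped Matrix.Norms.L2Operator

variable {n : ℕ}

/-- Used in both directions, this shows that `‖a‖‖b‖` is a 1-Lipschitz function of the
multiplication operator. -/
lemma fiber_norm_mul_norm_le {B : Type*} [CStarAlgebra B]
    (ψ : B ≃⋆ₐ[ℂ] Matrix (Fin n) (Fin n) ℂ) {a b a' b' : B} {ε : ℝ} (hε : 0 ≤ ε)
    (h : ∀ v, ‖a * v * b - a' * v * b'‖ ≤ ε * ‖v‖) : ‖a‖ * ‖b‖ ≤ ‖a'‖ * ‖b'‖ + ε := by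
  rw [← StarAlgEquiv.norm_map ψ a, ← StarAlgEquiv.norm_map ψ b]
  refine Matrix.norm_mul_norm_le_of_forall_mul_mul (by positivity) fun m ↦ ?_
  obtain ⟨v, rfl⟩ : ∃ v, ψ v = m := ψ.surjective m
  rw [← map_mul, ← map_mul, StarAlgEquiv.norm_map, StarAlgEquiv.norm_map]
  calc ‖a * v * b‖ = ‖(a * v * b - a' * v * b') + a' * v * b'‖ := by rw [sub_add_cancel]
    _ ≤ ε * ‖v‖ + ‖a'‖ * ‖v‖ * ‖b'‖ := norm_add_le_of_le (h v) (norm_mul₃_le)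
    _ = _ := by ring

lemma fiber_exists_mul_mul {B : Type*} [CStarAlgebra B]
    (ψ : B ≃⋆ₐ[ℂ] Matrix (Fin n) (Fin n) ℂ) {T : B → B}
    (h : ∀ ε > 0, ∃ a b : B, ∀ v, ‖a * v * b - T v‖ ≤ ε * ‖v‖) :
    ∃ a b : B, ∀ v, T v = a * v * b := by
  choose a b hab using fun k : ℕ ↦ h (1 / ((k : ℝ) + 1)) Nat.one_div_pos_of_nat
  obtain ⟨a', b', h'⟩ := Matrix.exists_mul_mul_of_tendsto (T := fun m ↦ ψ (T (ψ.symm m)))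
    (a := fun k ↦ ψ (a k)) (b := fun k ↦ ψ (b k)) fun m ↦ by
      rw [tendsto_iff_norm_sub_tendsto_zero]
      have hlim : Tendsto (fun k : ℕ ↦ 1 / ((k : ℝ) + 1) * ‖ψ.symm m‖) atTop (𝓝 0) := by
        simpa using tendsto_one_div_add_atTop_nhds_zero_nat.mul_const ‖ψ.symm m‖
      refine squeeze_zero (fun _ ↦ norm_nonneg _) (fun k ↦ ?_) hlim
      have hm : m = ψ (ψ.symm m) := (ψ.apply_symm_apply m).symm
      conv_lhs => rw [hm]
      rw [← map_mul, ← map_mul, ψ.symm_apply_apply, ← map_sub, StarAlgEquiv.norm_map]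
      exact hab k _
  refine ⟨ψ.symm a', ψ.symm b', fun v ↦ ψ.injective ?_⟩
  have := h' (ψ v)
  simp only [ψ.symm_apply_apply] at this
  change ψ (T v) = ψ _
  rw [this, map_mul, map_mul, ψ.apply_symm_apply, ψ.apply_symm_apply]

end Fibers

/-! ### From norm limits to phantom line subbundles -/

section Limits

open scoped Matrix.Norms.L2Operator

variable {X : Type*} [TopologicalSpace X] {n : ℕ} {E : X → Type*}
  [TopologicalSpace (TotalSpace (Matrix (Fin n) (Fin n) ℂ) E)]
  [∀ x, CStarAlgebra (E x)] [IsMatrixBundle n E]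

lemma fiber_norm_mul_norm_le_of_fiberTrace_eq_zero {x : X} {a b a' b' : E x} {ε : ℝ} (hε : 0 ≤ ε)
    (h : ∀ v, ‖a * v * b - a' * v * b'‖ ≤ ε * ‖v‖) (htr : fiberTrace n (star a * a') = 0) :
    ‖a‖ * ‖b‖ ≤ (n : ℝ) ^ 2 * ε := by
  obtain ⟨ψ⟩ := exists_fiberEquiv n E x
  rw [← StarAlgEquiv.norm_map ψ a, ← StarAlgEquiv.norm_map ψ b]
  rw [fiberTrace_eq ψ, map_mul, map_star] at htr
  refine Matrix.norm_mul_norm_le_of_trace_eq_zero (b' := ψ b') hε (fun m ↦ ?_) htr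
  obtain ⟨v, rfl⟩ : ∃ v, ψ v = m := ψ.surjective m
  rw [← map_mul, ← map_mul, ← map_mul, ← map_mul, ← map_sub, StarAlgEquiv.norm_map,
    StarAlgEquiv.norm_map]
  exact h v

/-- A norm limit of two-sided multiplications by elements of `A` acts fibrewise by two-sided
multiplications, and the approximation is uniform over the fibres. -/
lemma exists_fiberwise_mul_mul [T2Space X] [LocallyCompactSpace X]
    {φ : sectionAlgebra n E →L[ℂ] sectionAlgebra n E}
    (hφ : φ ∈ closure (twoSidedMulZero (sectionAlgebra n E))) :
    ∃ α β : ∀ x, E x,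
      (∀ (s : sectionAlgebra n E) x, (φ s : lp E ∞) x = α x * (s : lp E ∞) x * β x) ∧
      ∀ ε > 0, ∃ a b : sectionAlgebra n E, ∀ x (v : E x),
        ‖(a : lp E ∞) x * v * (b : lp E ∞) x - α x * v * β x‖ ≤ ε * ‖v‖ := by
  choose σ hσ hσv using fun (x : X) (v : E x) ↦ exists_section_apply_eq (n := n) v
  have happrox : ∀ ε > 0, ∃ a b : sectionAlgebra n E, ∀ (s : sectionAlgebra n E) x,
      ‖(a : lp E ∞) x * (s : lp E ∞) x * (b : lp E ∞) x - (φ s : lp E ∞) x‖ ≤ ε * ‖s‖ := by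
    intro ε hε
    obtain ⟨ψ, ⟨a, b, hab⟩, hψ⟩ := Metric.mem_closure_iff.1 hφ ε hε
    refine ⟨a, b, fun s x ↦ ?_⟩
    rw [dist_comm, dist_eq_norm] at hψ
    have h1 := (sectionAlgebra.norm_apply_le ((ψ - φ) s) x).trans ((ψ - φ).le_of_opNorm_le hψ.le s)
    rw [sub_apply, hab] at h1
    exact h1
  have hloc (x : X) : ∃ a b : E x, ∀ v, (φ (σ x v) : lp E ∞) x = a * v * b := by
    refine fiber_exists_mul_mul (exists_fiberEquiv n E x).some fun ε hε ↦ ?_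
    obtain ⟨a, b, hab⟩ := happrox ε hε
    refine ⟨(a : lp E ∞) x, (b : lp E ∞) x, fun v ↦ ?_⟩
    have := hab (σ x v) x
    rw [hσv] at this
    exact this.trans (by gcongr; exact hσ x v)
  choose α β hαβ using hloc
  refine ⟨α, β, fun s x ↦ ?_, fun ε hε ↦ ?_⟩
  -- The value of `φ s` at `x` depends only on `s x`: `s` and the chosen lift of `s x` agree at `x`,
  -- so every approximant sends them to the same value there.
  · rw [← hαβ, ← sub_eq_zero, ← norm_le_zero_iff]
    refine le_of_forall_pos_le_add fun δ hδ ↦ ?_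
    set C := ‖s‖ + ‖σ x ((s : lp E ∞) x)‖ with hC
    have hC0 : 0 ≤ C := by positivity
    obtain ⟨a, b, hab⟩ := happrox (δ / (C + 1)) (by positivity)
    have h1 := hab s x
    have h2 := hab (σ x ((s : lp E ∞) x)) x
    rw [hσv] at h2
    rw [norm_sub_rev] at h1
    calc ‖(φ s : lp E ∞) x - (φ (σ x ((s : lp E ∞) x)) : lp E ∞) x‖
        ≤ δ / (C + 1) * ‖s‖ + δ / (C + 1) * ‖σ x ((s : lp E ∞) x)‖ := by
          refine le_trans (le_of_eq ?_) (norm_add_le_of_le h1 h2)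
          congr 1; abel
      _ = δ * (C / (C + 1)) := by rw [hC]; ring
      _ ≤ δ * 1 := by gcongr; rw [div_le_one (by positivity)]; linarith
      _ = 0 + δ := by ring
  · obtain ⟨a, b, hab⟩ := happrox ε hε
    refine ⟨a, b, fun x v ↦ ?_⟩
    have := hab (σ x v) x
    rw [hσv, hαβ] at this
    exact this.trans (by gcongr; exact hσ x v)

variable (n) in
/-- The fibrewise two-sided multiplication `v ↦ α x v β x` is continuous in `x`: in local
trivializations it maps constant sections to continuous ones. -/
def MulMulContinuousAt (α β : ∀ x, E x) (x : X) : Prop :=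
  ∀ e : Trivialization (Matrix (Fin n) (Fin n) ℂ) (π (Matrix (Fin n) (Fin n) ℂ) E),
    IsStarTrivialization e → x ∈ e.baseSet → ∀ m : Matrix (Fin n) (Fin n) ℂ,
      ContinuousAt (fun y ↦ (e ⟨y, α y⟩).2 * m * (e ⟨y, β y⟩).2) x

omit [IsMatrixBundle n E] in
lemma MulMulContinuousAt.congr {α β α' β' : ∀ x, E x} {x : X} (h : MulMulContinuousAt n α β x)
    (h' : ∀ᶠ y in 𝓝 x, ∀ v, α y * v * β y = α' y * v * β' y) : MulMulContinuousAt n α' β' x := by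
  intro e he hx m
  refine (h e he hx m).congr ?_
  filter_upwards [h', e.open_baseSet.mem_nhds hx] with y hy hye
  obtain ⟨ψ, hψ⟩ := he y hye
  have := congrArg ψ (hy (ψ.symm m))
  simpa only [hψ, map_mul, ψ.apply_symm_apply] using this

lemma mulMulContinuousAt_of_forall [T2Space X] [LocallyCompactSpace X]
    {φ : sectionAlgebra n E → sectionAlgebra n E} {α β : ∀ x, E x}
    (h : ∀ (s : sectionAlgebra n E) x, (φ s : lp E ∞) x = α x * (s : lp E ∞) x * β x) (x : X) :
    MulMulContinuousAt n α β x := by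
  intro e he hx m
  obtain ⟨s, -, hs⟩ := exists_section_eventually_eq he hx m
  have hc := sectionAlgebra.sectionContinuousWithinAt (φ s) Set.univ x
  rw [sectionContinuousWithinAt_iff e hx, continuousWithinAt_univ] at hc
  refine hc.congr ?_
  filter_upwards [hs, e.open_baseSet.mem_nhds hx] with y hy hye
  obtain ⟨ψ, hψ⟩ := he y hye
  rw [hψ] at hy
  simp only [h, hψ, map_mul, (Prod.mk.inj hy).2]

/-- Although `α` may be discontinuous, the products `α p i * β k q` are entries of the images of
matrix units and hence continuous. So `β k q • α` is a local frame wherever it is nonzero. -/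
lemma MulMulContinuousAt.exists_isLineFrameOn {α β : ∀ x, E x}
    (h : ∀ x, MulMulContinuousAt n α β x) {x : X} (hα : α x ≠ 0) (hβ : β x ≠ 0) :
    ∃ (V : Set X) (s : ∀ x, E x), IsOpen V ∧ x ∈ V ∧ IsLineFrameOn n (fun y ↦ ℂ ∙ α y) s V := by
  obtain ⟨e, hx, he⟩ := exists_isStarTrivialization n E x
  obtain ⟨k, q, hkq⟩ : ∃ k q, (e ⟨x, β x⟩).2 k q ≠ 0 := by
    by_contra! h0
    obtain ⟨ψ, hψ⟩ := he x hx
    refine hβ (ψ.injective ?_)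
    refine Eq.trans (Matrix.ext fun k q ↦ ?_) (map_zero ψ).symm
    have := h0 k q
    rw [hψ] at this
    exact this
  let s : ∀ y, E y := fun y ↦ (e ⟨y, β y⟩).2 k q • α y
  have hs (y) (hy : y ∈ e.baseSet) : SectionContinuousWithinAt n s e.baseSet y := by
    rw [sectionContinuousWithinAt_iff e hy]
    refine ContinuousAt.continuousWithinAt ?_
    have h1 : ContinuousAt (fun z ↦ Matrix.of fun p i ↦
        ((e ⟨z, α z⟩).2 * (Matrix.single i k 1 : Matrix (Fin n) (Fin n) ℂ) * (e ⟨z, β z⟩).2) p q) y := by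
      refine continuousAt_pi.2 fun p ↦ continuousAt_pi.2 fun i ↦ ?_
      exact continuousAt_pi.1 (continuousAt_pi.1 (h y e he hy (Matrix.single i k 1)) p) q
    refine h1.congr ?_
    filter_upwards [e.open_baseSet.mem_nhds hy] with z hz
    obtain ⟨ψ, hψ⟩ := he z hz
    ext p i
    simp only [Matrix.of_apply, Matrix.mul_single_mul_apply, s, hψ, map_smul, Matrix.smul_apply,
      smul_eq_mul, mul_comm]
  have hopen : IsOpen (e.baseSet ∩ (fun y ↦ ‖s y‖) ⁻¹' {0}ᶜ) :=
    ContinuousOn.isOpen_inter_preimage (fun y hy ↦ (hs y hy).norm) e.open_baseSet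
      isOpen_compl_singleton
  refine ⟨_, s, hopen, ⟨hx, ?_⟩, fun y ⟨hy, hy0⟩ ↦ ?_⟩
  · simp [s, hkq, hα]
  · have hsy : s y ≠ 0 := by simpa using hy0
    refine ⟨(hs y hy).mono Set.inter_subset_left, hsy, ?_⟩
    have hc : (e ⟨y, β y⟩).2 k q ≠ 0 := fun h0 ↦ hsy (by simp [s, h0])
    exact (Submodule.span_singleton_smul_eq (IsUnit.mk0 _ hc) _).symm

/-- Near `x` the entries of `t` are quotients of the continuous products `s p i * t k q` by a
nonzero entry `s p i`. -/
lemma MulMulContinuousAt.sectionContinuousWithinAt_right {s t : ∀ x, E x} {x : X}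
    (h : MulMulContinuousAt n s t x) (hs : SectionContinuousWithinAt n s Set.univ x)
    (hsx : s x ≠ 0) : SectionContinuousWithinAt n t Set.univ x := by
  obtain ⟨e, hx, he⟩ := exists_isStarTrivialization n E x
  rw [sectionContinuousWithinAt_iff e hx, continuousWithinAt_univ] at hs ⊢
  obtain ⟨p, i, hpi⟩ : ∃ p i, (e ⟨x, s x⟩).2 p i ≠ 0 := by
    by_contra! h0
    obtain ⟨ψ, hψ⟩ := he x hx
    refine hsx (ψ.injective ?_)
    refine Eq.trans (Matrix.ext fun k q ↦ ?_) (map_zero ψ).symm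
    have := h0 k q
    rw [hψ] at this
    exact this
  have hspi : ContinuousAt (fun y ↦ (e ⟨y, s y⟩).2 p i) x :=
    continuousAt_pi.1 (continuousAt_pi.1 hs p) i
  refine continuousAt_pi.2 fun k ↦ continuousAt_pi.2 fun q ↦ ?_
  have h1 : ContinuousAt (fun z ↦ ((e ⟨z, s z⟩).2 * Matrix.single i k (1 : ℂ) *
      (e ⟨z, t z⟩).2) p q) x :=
    continuousAt_pi.1 (continuousAt_pi.1 (h e he hx (Matrix.single i k 1)) p) q
  refine (h1.div hspi hpi).congr ?_
  filter_upwards [hspi.eventually_ne hpi] with y hy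
  simp only [Pi.div_apply, Matrix.mul_single_mul_apply]
  field_simp

lemma continuous_and_tendsto_norm_mul_norm {α β : ∀ x, E x}
    (h : ∀ ε > 0, ∃ a b : sectionAlgebra n E, ∀ x (v : E x),
        ‖(a : lp E ∞) x * v * (b : lp E ∞) x - α x * v * β x‖ ≤ ε * ‖v‖) :
    Continuous (fun x ↦ ‖α x‖ * ‖β x‖) ∧
      Tendsto (fun x ↦ ‖α x‖ * ‖β x‖) (cocompact X) (𝓝 0) := by
  have key : ∀ ε > 0, ∃ f : X → ℝ, Continuous f ∧ Tendsto f (cocompact X) (𝓝 0) ∧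
      ∀ x, |‖α x‖ * ‖β x‖ - f x| ≤ ε := by
    intro ε hε
    obtain ⟨a, b, hab⟩ := h ε hε
    refine ⟨fun x ↦ ‖(a : lp E ∞) x‖ * ‖(b : lp E ∞) x‖, ?_, ?_, fun x ↦ ?_⟩
    · refine continuous_iff_continuousAt.2 fun x ↦ (continuousWithinAt_univ _ _).1 ?_
      exact (sectionAlgebra.sectionContinuousWithinAt a _ x).norm.mul (sectionAlgebra.sectionContinuousWithinAt b _ x).norm
    · simpa using (sectionAlgebra.tendsto_norm a).mul (sectionAlgebra.tendsto_norm b)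
    · have h1 := fiber_norm_mul_norm_le (exists_fiberEquiv n E x).some hε.le (hab x)
      have h2 := fiber_norm_mul_norm_le (exists_fiberEquiv n E x).some hε.le
        (fun v ↦ (norm_sub_rev (α x * v * β x) _).trans_le (hab x v))
      rw [abs_le]
      constructor <;> linarith
  constructor
  · refine continuous_of_uniform_approx_of_continuous fun u hu ↦ ?_
    obtain ⟨ε, hε, hεu⟩ := Metric.mem_uniformity_dist.1 hu
    obtain ⟨f, hf, -, hNf⟩ := key (ε / 2) (half_pos hε)
    exact ⟨f, hf, fun y ↦ hεu ((hNf y).trans_lt (half_lt_self hε))⟩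
  · rw [Metric.tendsto_nhds]
    intro ε hε
    obtain ⟨f, -, hf, hNf⟩ := key (ε / 2) (half_pos hε)
    filter_upwards [Metric.tendsto_nhds.1 hf (ε / 2) (half_pos hε)] with x hx
    rw [Real.dist_0_eq_abs] at hx ⊢
    have := abs_add_le (‖α x‖ * ‖β x‖ - f x) (f x)
    rw [sub_add_cancel] at this
    linarith [hNf x]

lemma isSigmaCompact_of_tendsto {N : X → ℝ} (hN : Continuous N) (hN0 : ∀ x, 0 ≤ N x)
    (h : Tendsto N (cocompact X) (𝓝 0)) : IsSigmaCompact {x | N x ≠ 0} := by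
  refine ⟨fun k : ℕ ↦ {x | 1 / ((k : ℝ) + 1) ≤ N x}, fun k ↦ ?_, ?_⟩
  · have hk : (0 : ℝ) < 1 / ((k : ℝ) + 1) := Nat.one_div_pos_of_nat
    obtain ⟨K, hK, hKc⟩ := mem_cocompact.1 (h.eventually (gt_mem_nhds hk))
    refine hK.of_isClosed_subset (isClosed_le continuous_const hN) fun x hx ↦ ?_
    by_contra hxK
    have hlt : N x < 1 / ((k : ℝ) + 1) := hKc hxK
    exact not_lt.2 hx hlt
  · ext x
    simp only [Set.mem_iUnion, Set.mem_ofPred_eq]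
    constructor
    · rintro ⟨k, hk⟩
      exact (Nat.one_div_pos_of_nat.trans_le hk).ne'
    · intro hx
      obtain ⟨k, hk⟩ := exists_nat_one_div_lt ((hN0 x).lt_of_ne' hx)
      exact ⟨k, hk.le⟩

/-- Projecting an approximant onto the line field spanned by `α` gives a frame over a compact
set. -/
lemma isTrivialLineBundleOn_of_isCompact {α β : ∀ x, E x}
    (hcont : ∀ x, MulMulContinuousAt n α β x)
    (happrox : ∀ ε > 0, ∃ a b : sectionAlgebra n E, ∀ x (v : E x),
        ‖(a : lp E ∞) x * v * (b : lp E ∞) x - α x * v * β x‖ ≤ ε * ‖v‖)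
    {K : Set X} (hK : IsCompact K) (hKU : ∀ x ∈ K, ‖α x‖ * ‖β x‖ ≠ 0) :
    IsTrivialLineBundleOn n (fun x ↦ ℂ ∙ α x) K := by
  obtain ⟨δ, hδ, hKδ⟩ := hK.exists_forall_le'
    (continuous_and_tendsto_norm_mul_norm happrox).1.continuousOn
    (fun x hx ↦ lt_of_le_of_ne (by positivity) (hKU x hx).symm)
  -- With this accuracy the orthogonality estimate would give `‖α x‖‖β x‖ < δ`, so `a x` is never
  -- orthogonal to `α x` on `K`.
  obtain ⟨a, b, hab⟩ := happrox (δ / ((n : ℝ) ^ 2 + 1)) (by positivity)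
  have htr (x) (hx : x ∈ K) : fiberTrace n (star (α x) * (a : lp E ∞) x) ≠ 0 := by
    intro h0
    have h1 := fiber_norm_mul_norm_le_of_fiberTrace_eq_zero (by positivity)
      (fun v ↦ (norm_sub_rev (α x * v * β x) _).trans_le (hab x v)) h0
    have h2 : (n : ℝ) ^ 2 * (δ / ((n : ℝ) ^ 2 + 1)) < δ := by
      rw [mul_div_assoc', div_lt_iff₀ (by positivity)]
      nlinarith
    linarith [hKδ x hx]
  refine isTrivialLineBundleOn_iff.2 ⟨fun x ↦ (fiberTrace n (star (α x) * (a : lp E ∞) x) /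
    fiberTrace n (star (α x) * α x)) • α x, fun x hx ↦ ?_⟩
  have hα : α x ≠ 0 := norm_ne_zero_iff.1 (left_ne_zero_of_mul (hKU x hx))
  have hβ : β x ≠ 0 := norm_ne_zero_iff.1 (right_ne_zero_of_mul (hKU x hx))
  have hc : fiberTrace n (star (α x) * (a : lp E ∞) x) / fiberTrace n (star (α x) * α x) ≠ 0 :=
    div_ne_zero (htr x hx) (fiberTrace_star_mul_self_eq_zero.not.2 hα)
  refine ⟨?_, smul_ne_zero hc hα, (Submodule.span_singleton_smul_eq (IsUnit.mk0 _ hc) _).symm⟩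
  obtain ⟨V, s, hV, hxV, hs⟩ := MulMulContinuousAt.exists_isLineFrameOn hcont hα hβ
  -- The orthogonal projection of `a y` depends only on the line, so the continuous local frame `s`
  -- may replace `α`.
  have heq (y) (hy : y ∈ V) : (fiberTrace n (star (α y) * (a : lp E ∞) y) /
      fiberTrace n (star (α y) * α y)) • α y = (fiberTrace n (star (s y) * (a : lp E ∞) y) /
      fiberTrace n (star (s y) * s y)) • s y := by
    obtain ⟨-, hsy, hspan⟩ := hs y hy
    obtain ⟨c, hc⟩ := Submodule.mem_span_singleton.1
      ((SetLike.ext_iff.1 hspan (s y)).2 (Submodule.mem_span_singleton_self _))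
    have hc0 : c ≠ 0 := by
      rintro rfl
      exact hsy (by rw [← hc, zero_smul])
    simp only [← hc, star_smul, smul_mul_assoc, mul_smul_comm, fiberTrace_smul, smul_smul]
    have : star c ≠ 0 := star_ne_zero.2 hc0
    congr 1
    field_simp
  have hsc : SectionContinuousWithinAt n s K x :=
    (hs x hxV).1.mono_of_mem_nhdsWithin (mem_nhdsWithin_of_mem_nhds (hV.mem_nhds hxV))
  have hq := (hsc.star.mul (sectionAlgebra.sectionContinuousWithinAt a K x)).fiberTrace.div
    (hsc.star.mul hsc).fiberTrace (fiberTrace_star_mul_self_eq_zero.not.2 (hs x hxV).2.1)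
  refine (hsc.smul hq).congr_of_eventuallyEq ?_ (heq x hxV)
  filter_upwards [mem_nhdsWithin_of_mem_nhds (hV.mem_nhds hxV)] with y hy
  exact heq y hy

/-- If the line field spanned by `α` is trivial where it does not vanish, then the fibrewise
multiplication by `α` and `β` is implemented by sections vanishing at infinity. -/
lemma exists_sections_of_isLineFrameOn {α β s : ∀ x, E x}
    (hcont : ∀ x, MulMulContinuousAt n α β x)
    (hN : Continuous fun x ↦ ‖α x‖ * ‖β x‖)
    (hN0 : Tendsto (fun x ↦ ‖α x‖ * ‖β x‖) (cocompact X) (𝓝 0))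
    (hs : IsLineFrameOn n (fun x ↦ ℂ ∙ α x) s {x | ‖α x‖ * ‖β x‖ ≠ 0}) :
    ∃ a b : sectionAlgebra n E, ∀ x (v : E x),
      (a : lp E ∞) x * v * (b : lp E ∞) x = α x * v * β x := by
  classical
  set N : X → ℝ := fun x ↦ ‖α x‖ * ‖β x‖ with hNdef
  have hNpos (x) (hx : N x ≠ 0) : 0 < N x := lt_of_le_of_ne (by positivity) hx.symm
  have hU : IsOpen {x | N x ≠ 0} := isOpen_ne_fun hN continuous_const
  have hspan (x) (hx : N x ≠ 0) : ∃ c : ℂ, c • s x = α x :=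
    Submodule.mem_span_singleton.1
      ((SetLike.ext_iff.1 (hs x hx).2.2 (α x)).1 (Submodule.mem_span_singleton_self _))
  choose! c hc using hspan
  -- The norm is split evenly: `a` and `b` both have norm `√N`, so both vanish at infinity and are
  -- continuous at the zeros of `N`. The scalar `c`, with `α = c • s`, is absorbed into `b`.
  let a : ∀ x, E x := fun x ↦ if N x ≠ 0 then ((√(N x) / ‖s x‖ : ℝ) : ℂ) • s x else 0
  let b : ∀ x, E x := fun x ↦ if N x ≠ 0 then ((‖s x‖ / √(N x) : ℝ) : ℂ) • c x • β x else 0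
  have ha (x) (hx : N x ≠ 0) : a x = ((√(N x) / ‖s x‖ : ℝ) : ℂ) • s x := if_pos hx
  have hb (x) (hx : N x ≠ 0) : b x = ((‖s x‖ / √(N x) : ℝ) : ℂ) • c x • β x := if_pos hx
  have ha0 (x) (hx : N x = 0) : a x = 0 := if_neg (by simpa using hx)
  have hb0 (x) (hx : N x = 0) : b x = 0 := if_neg (by simpa using hx)
  have hmul (x) (v : E x) : a x * v * b x = α x * v * β x := by
    by_cases hx : N x = 0
    · rw [ha0 x hx, zero_mul, zero_mul]
      rcases mul_eq_zero.1 hx with h | h <;> rw [norm_eq_zero] at h <;> simp [h]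
    · have h1 : ‖s x‖ ≠ 0 := norm_ne_zero_iff.2 (hs x hx).2.1
      have h2 : √(N x) ≠ 0 := (Real.sqrt_pos.2 (hNpos x hx)).ne'
      rw [ha x hx, hb x hx, ← hc x hx]
      simp only [smul_mul_assoc, mul_smul_comm, smul_smul]
      rw [mul_right_comm, ← Complex.ofReal_mul,
        show ‖s x‖ / √(N x) * (√(N x) / ‖s x‖) = 1 by field_simp, Complex.ofReal_one, one_mul]
  have hsN : Tendsto (fun x ↦ √(N x)) (cocompact X) (𝓝 0) := by
    simpa [Function.comp_def] using (Real.continuous_sqrt.tendsto 0).comp hN0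
  have han (x) : ‖a x‖ = √(N x) := by
    by_cases hx : N x = 0
    · simp [ha0 x hx, hx]
    · have h1 : ‖s x‖ ≠ 0 := norm_ne_zero_iff.2 (hs x hx).2.1
      rw [ha x hx, norm_smul, Complex.norm_of_nonneg (by positivity)]
      field_simp
  have hbn (x) : ‖b x‖ = √(N x) := by
    by_cases hx : N x = 0
    · simp [hb0 x hx, hx]
    · have h2 : √(N x) ≠ 0 := (Real.sqrt_pos.2 (hNpos x hx)).ne'
      have h3 : ‖s x‖ * (‖c x‖ * ‖β x‖) = √(N x) * √(N x) := by
        rw [Real.mul_self_sqrt (hNpos x hx).le, hNdef]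
        dsimp only
        rw [← hc x hx, norm_smul]; ring
      rw [hb x hx, norm_smul, norm_smul, Complex.norm_of_nonneg (by positivity), div_mul_eq_mul_div,
        h3]
      field_simp
  have hsqrt0 (x) (hx : N x = 0) : Tendsto (fun y ↦ √(N y)) (𝓝[Set.univ] x) (𝓝 0) := by
    have := hN.sqrt.tendsto x
    rw [hx, Real.sqrt_zero] at this
    exact this.mono_left nhdsWithin_le_nhds
  have hac : IsContinuousSection n E a := by
    refine isContinuousSection_iff.2 fun x ↦ ?_
    by_cases hx : N x = 0
    · exact .of_norm (ha0 x hx) (by simpa only [han] using hsqrt0 x hx)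
    · have hsx : SectionContinuousWithinAt n s Set.univ x := (hs x hx).1.mono_of_mem_nhdsWithin
        (mem_nhdsWithin_of_mem_nhds (hU.mem_nhds hx))
      have hq : ContinuousWithinAt (fun y ↦ ((√(N y) / ‖s y‖ : ℝ) : ℂ)) Set.univ x :=
        Complex.continuous_ofReal.continuousAt.comp_continuousWithinAt
          (hN.sqrt.continuousWithinAt.div hsx.norm (norm_ne_zero_iff.2 (hs x hx).2.1))
      refine (hsx.smul hq).congr_of_eventuallyEq ?_ (ha x hx)
      filter_upwards [mem_nhdsWithin_of_mem_nhds (hU.mem_nhds hx)] with y hy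
      exact ha y hy
  have hbc : IsContinuousSection n E b := by
    refine isContinuousSection_iff.2 fun x ↦ ?_
    by_cases hx : N x = 0
    · exact .of_norm (hb0 x hx) (by simpa only [hbn] using hsqrt0 x hx)
    -- Neither `c` nor `β` is known to be continuous; continuity of `b` is inherited from the
    -- operator and from `a ≠ 0`.
    · refine MulMulContinuousAt.sectionContinuousWithinAt_right
        ((hcont x).congr (.of_forall fun y v ↦ (hmul y v).symm)) (isContinuousSection_iff.1 hac x) ?_
      rw [← norm_ne_zero_iff, han]
      exact (Real.sqrt_pos.2 (hNpos x hx)).ne'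
  obtain ⟨a', ha'⟩ := exists_mem_sectionAlgebra hac (by simpa only [han] using hsN)
  obtain ⟨b', hb'⟩ := exists_mem_sectionAlgebra hbc (by simpa only [hbn] using hsN)
  exact ⟨a', b', fun x v ↦ by rw [ha', hb', hmul]⟩

lemma exists_isPhantomLineSubbundleOn [T2Space X] [LocallyCompactSpace X]
    (h : ¬ IsClosed (twoSidedMulZero (sectionAlgebra n E))) :
    ∃ U : Set X, IsOpen U ∧ IsSigmaCompact U ∧
      ∃ L : ∀ x, Submodule ℂ (E x), IsPhantomLineSubbundleOn n L U := by
  obtain ⟨φ, hφ, hφ'⟩ : ∃ φ ∈ closure (twoSidedMulZero (sectionAlgebra n E)),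
      φ ∉ twoSidedMulZero (sectionAlgebra n E) := by
    by_contra! h'
    exact h (isClosed_of_closure_subset h')
  obtain ⟨α, β, hαβ, happrox⟩ := exists_fiberwise_mul_mul hφ
  obtain ⟨hN, hN0⟩ := continuous_and_tendsto_norm_mul_norm happrox
  have hcont := mulMulContinuousAt_of_forall hαβ
  refine ⟨{x | ‖α x‖ * ‖β x‖ ≠ 0}, isOpen_ne_fun hN continuous_const,
    isSigmaCompact_of_tendsto hN (fun x ↦ by positivity) hN0, fun x ↦ ℂ ∙ α x,
    fun x hx ↦ ?_, fun htriv ↦ ?_, fun K hKU hK ↦ ?_⟩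
  · obtain ⟨V, s, hV, hxV, hs⟩ := MulMulContinuousAt.exists_isLineFrameOn hcont
      (norm_ne_zero_iff.1 (left_ne_zero_of_mul hx)) (norm_ne_zero_iff.1 (right_ne_zero_of_mul hx))
    exact ⟨V, hV, hxV, (hs.mono Set.inter_subset_left).isTrivialLineBundleOn⟩
  · obtain ⟨s, hs⟩ := htriv.exists_isLineFrameOn
    obtain ⟨a, b, hab⟩ := exists_sections_of_isLineFrameOn hcont hN hN0 hs
    refine hφ' ⟨a, b, fun t ↦ sectionAlgebra.ext fun x ↦ ?_⟩
    rw [hαβ, ← hab]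
    rfl
  · exact isTrivialLineBundleOn_of_isCompact hcont happrox hK hKU

end Limits

/-! ### Multipliers cut down to the algebra -/

section Multipliers

variable {A : Type*} [NonUnitalCStarAlgebra A]

lemma twoSidedMulZero_subset_twoSidedMul : twoSidedMulZero A ⊆ twoSidedMul A := by
  rintro φ ⟨a, b, h⟩
  refine ⟨a, b, fun x ↦ ?_⟩
  have hmul (y z : A) : ((y * z : A) : 𝓜(ℂ, A)) = y * z :=
    map_mul (DoubleCentralizer.coeHom (𝕜 := ℂ) (A := A)) y z
  rw [h, hmul, hmul]

lemma eq_of_forall_mul_right_eq {x y : A} (h : ∀ z, x * z = y * z) : x = y := by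
  rw [← sub_eq_zero, ← CStarRing.mul_star_self_eq_zero_iff, sub_mul, h, sub_self]

lemma eq_of_forall_mul_left_eq {x y : A} (h : ∀ z, z * x = z * y) : x = y := by
  rw [← sub_eq_zero, ← CStarRing.star_mul_self_eq_zero_iff, mul_sub, h, sub_self]

/-- Compressing a two-sided multiplication by multipliers with an element of `A` gives a two-sided
multiplication by elements of `A`. -/
lemma exists_mul_mul_of_mem_twoSidedMul {φ : A →L[ℂ] A} (hφ : φ ∈ twoSidedMul A) (e : A) :
    ∃ p q : A, ∀ s, φ (e * s * e) = p * s * q := by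
  obtain ⟨a, b, h⟩ := hφ
  -- These are the products `a e` and `e b`, which lie in `A`.
  refine ⟨a.fst e, b.snd e, fun s ↦ eq_of_forall_mul_right_eq fun y ↦ ?_⟩
  have h1 : φ (e * s * e) * y = a.fst ((e * s * e) * b.fst y) :=
    congrArg (fun m : 𝓜(ℂ, A) ↦ m.fst y) (h (e * s * e))
  have h2 (w : A) : a.fst (e * w) = a.fst e * w := eq_of_forall_mul_left_eq fun z ↦ by
    rw [← a.central, ← mul_assoc, ← mul_assoc, a.central]
  rw [h1, mul_assoc, ← b.central, mul_assoc, h2]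
  simp only [mul_assoc]

end Multipliers

/-! ### From phantom line subbundles to limits outside `TM(A)` -/

section PhantomBundles

open scoped Matrix.Norms.L2Operator

/-- The operator determines the line of its left factor: on matrix units it gives `a p i * b k q =
a' p i * b' k q`, and some `b k q` is nonzero. -/
lemma exists_smul_eq_of_mul_mul_eq {n : ℕ} {B : Type*} [CStarAlgebra B]
    (ψ : B ≃⋆ₐ[ℂ] Matrix (Fin n) (Fin n) ℂ) {a b a' b' : B}
    (h : ∀ v, a * v * b = a' * v * b') (ha : a ≠ 0) (hb : b ≠ 0) : ∃ c : ℂ, c ≠ 0 ∧ a = c • a' := by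
  obtain ⟨k, q, hkq⟩ : ∃ k q, ψ b k q ≠ 0 := by
    by_contra! h0
    exact hb (ψ.injective (Eq.trans (Matrix.ext h0) (map_zero ψ).symm))
  have heq : a = (ψ b' k q / ψ b k q) • a' := by
    refine ψ.injective (Eq.trans (Matrix.ext fun p i ↦ ?_) (map_smul ψ _ a').symm)
    have h1 := congrArg (fun v ↦ ψ v p q) (h (ψ.symm (Matrix.single i k 1)))
    simp only [map_mul, ψ.apply_symm_apply, Matrix.mul_single_mul_apply] at h1
    rw [Matrix.smul_apply, smul_eq_mul]
    change ψ a p i = _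
    field_simp
    linear_combination h1
  refine ⟨_, fun h0 ↦ ha ?_, heq⟩
  rw [heq, h0, zero_smul]

variable {X : Type*} [TopologicalSpace X]

/-- The function is `∑ 2⁻ᵏ g k`, where `g k` is a compactly supported Urysohn function equal to one
on the `k`-th compact set and to zero off `U`. The bound 2 is the sum of the weights. -/
lemma exists_continuous_tendsto_of_isSigmaCompact [T2Space X] [LocallyCompactSpace X] {U : Set X}
    (hU : IsOpen U) (hσ : IsSigmaCompact U) :
    ∃ f : X → ℝ, Continuous f ∧ (∀ x, 0 ≤ f x ∧ f x ≤ 2) ∧ (∀ x, f x ≠ 0 ↔ x ∈ U) ∧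
      Tendsto f (cocompact X) (𝓝 0) := by
  obtain ⟨K, hK, hKU⟩ := hσ
  choose g hg1 hg0 hgc hg using fun k : ℕ ↦ exists_continuous_one_zero_of_isCompact (hK k)
    hU.isClosed_compl (Set.disjoint_compl_right_iff_subset.2 (hKU ▸ Set.subset_iUnion K k))
  have hpos (k : ℕ) (x : X) : 0 ≤ (1 / 2 : ℝ) ^ k * g k x := mul_nonneg (by positivity) (hg k x).1
  have hle (k : ℕ) (x : X) : (1 / 2 : ℝ) ^ k * g k x ≤ (1 / 2) ^ k :=
    mul_le_of_le_one_right (by positivity) (hg k x).2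
  have hnorm (k : ℕ) (x : X) : ‖(1 / 2 : ℝ) ^ k * g k x‖ ≤ (1 / 2) ^ k := by
    rw [Real.norm_of_nonneg (hpos k x)]; exact hle k x
  have hsum (x : X) : Summable fun k : ℕ ↦ (1 / 2 : ℝ) ^ k * g k x :=
    summable_geometric_two.of_nonneg_of_le (hpos · x) (hle · x)
  refine ⟨fun x ↦ ∑' k : ℕ, (1 / 2 : ℝ) ^ k * g k x,
    continuous_tsum (fun k ↦ by fun_prop) summable_geometric_two hnorm, fun x ↦
    ⟨tsum_nonneg (hpos · x), ?_⟩, fun x ↦ ⟨fun h ↦ ?_, fun h ↦ ?_⟩, ?_⟩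
  · exact ((hsum x).tsum_le_tsum (hle · x) summable_geometric_two).trans_eq tsum_geometric_two
  · by_contra hx
    refine h ?_
    simp [fun k ↦ hg0 k hx]
  · rw [← hKU] at h
    obtain ⟨k, hk⟩ := Set.mem_iUnion.1 h
    refine ((hsum x).tsum_pos (hpos · x) k ?_).ne'
    rw [hg1 k hk]
    simp
  · have := tendsto_tsum_of_dominated_convergence (𝓕 := cocompact X)
      (f := fun x k ↦ (1 / 2 : ℝ) ^ k * g k x) (g := fun _ ↦ 0) summable_geometric_two
      (fun k ↦ ?_) (.of_forall fun x k ↦ hnorm k x)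
    · simpa using this
    · refine tendsto_const_nhds.congr' ?_
      filter_upwards [(hgc k).isCompact.compl_mem_cocompact] with x hx
      rw [image_eq_zero_of_notMem_tsupport hx, mul_zero]

variable {n : ℕ} {E : X → Type*}
  [TopologicalSpace (TotalSpace (Matrix (Fin n) (Fin n) ℂ) E)]
  [∀ x, CStarAlgebra (E x)] [IsMatrixBundle n E]

omit [IsMatrixBundle n E] in
lemma IsLineSubbundleOn.exists_isLineFrameOn {L : ∀ x, Submodule ℂ (E x)} {U : Set X}
    (hU : IsOpen U) (hL : IsLineSubbundleOn n L U) {x : X} (hx : x ∈ U) :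
    ∃ (V : Set X) (s : ∀ x, E x), IsOpen V ∧ x ∈ V ∧ V ⊆ U ∧ IsLineFrameOn n L s V := by
  obtain ⟨V, hV, hxV, h⟩ := hL x hx
  obtain ⟨s, hs⟩ := h.exists_isLineFrameOn
  exact ⟨V ∩ U, s, hV.inter hU, ⟨hxV, hx⟩, Set.inter_subset_right, hs⟩

omit [IsMatrixBundle n E] in
/-- Choose unit vectors `α x` in the lines `L x`. -/
lemma IsLineSubbundleOn.exists_unit {L : ∀ x, Submodule ℂ (E x)} {U : Set X}
    (hU : IsOpen U) (hL : IsLineSubbundleOn n L U) :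
    ∃ α : ∀ x, E x, ∀ x ∈ U, ‖α x‖ = 1 ∧ L x = ℂ ∙ α x := by
  have key (x) (hx : x ∈ U) : ∃ v : E x, ‖v‖ = 1 ∧ L x = ℂ ∙ v := by
    obtain ⟨V, s, -, hxV, -, hs⟩ := hL.exists_isLineFrameOn hU hx
    obtain ⟨-, h0, hspan⟩ := hs x hxV
    have hn : ‖s x‖ ≠ 0 := norm_ne_zero_iff.2 h0
    refine ⟨((‖s x‖⁻¹ : ℝ) : ℂ) • s x, ?_, ?_⟩
    · rw [norm_smul, Complex.norm_of_nonneg (by positivity), inv_mul_cancel₀ hn]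
    · rw [hspan]
      refine (Submodule.span_singleton_smul_eq (IsUnit.mk0 _ ?_) _).symm
      exact_mod_cast inv_ne_zero hn
  classical
  refine ⟨fun x ↦ if hx : x ∈ U then (key x hx).choose else 0, fun x hx ↦ ?_⟩
  simp only [hx, dif_pos]
  exact (key x hx).choose_spec

/-- The phase of `a` cancels in `a v a*`. Unit vectors chosen without continuity can thus be traded
for a continuous local frame. -/
lemma smul_mul_mul_star_eq_of_span_eq {B : Type*} [CStarAlgebra B] {a s : B} (ha : ‖a‖ = 1)
    (hs : s ≠ 0) (h : (ℂ ∙ a : Submodule ℂ B) = ℂ ∙ s) (v : B) :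
    a * v * star a = (((‖s‖ ^ 2)⁻¹ : ℝ) : ℂ) • (s * v * star s) := by
  obtain ⟨c, rfl⟩ := Submodule.mem_span_singleton.1
    ((SetLike.ext_iff.1 h s).2 (Submodule.mem_span_singleton_self s))
  have hc : c ≠ 0 := by
    rintro rfl
    simp at hs
  simp only [norm_smul, ha, mul_one, star_smul, smul_mul_assoc, mul_smul_comm, smul_smul]
  have h1 : star c * c = ((‖c‖ ^ 2 : ℝ) : ℂ) := by
    rw [Complex.star_def, Complex.conj_mul']
    push_cast; rfl
  have h2 : ‖c‖ ^ 2 ≠ 0 := pow_ne_zero _ (norm_ne_zero_iff.2 hc)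
  rw [mul_assoc a, h1, ← Complex.ofReal_mul, inv_mul_cancel₀ h2, Complex.ofReal_one,
    one_smul]

/-- The bounded operator on sections given by the fibrewise formula `v ↦ f x • α x v (α x)*`. -/
lemma exists_continuousLinearMap_conj {L : ∀ x, Submodule ℂ (E x)} {U : Set X}
    (hU : IsOpen U) (hL : IsLineSubbundleOn n L U) {α : ∀ x, E x}
    (hα : ∀ x ∈ U, ‖α x‖ = 1 ∧ L x = ℂ ∙ α x) {f : X → ℝ} (hf : Continuous f)
    (hf2 : ∀ x, 0 ≤ f x ∧ f x ≤ 2) (hfU : ∀ x, f x ≠ 0 ↔ x ∈ U) :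
    ∃ φ : sectionAlgebra n E →L[ℂ] sectionAlgebra n E, ∀ s x,
      (φ s : lp E ∞) x = (f x : ℂ) • (α x * (s : lp E ∞) x * star (α x)) := by
  have hf0 (x) (hx : x ∉ U) : f x = 0 := not_not.1 ((hfU x).not.2 hx)
  have hnorm (v : ∀ x, E x) (x) : ‖(f x : ℂ) • (α x * v x * star (α x))‖ ≤ f x * ‖v x‖ := by
    by_cases hx : x ∈ U
    · rw [norm_smul, Complex.norm_of_nonneg (hf2 x).1]
      refine mul_le_mul_of_nonneg_left (norm_mul₃_le.trans ?_) (hf2 x).1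
      rw [norm_star, (hα x hx).1, one_mul, mul_one]
    · simp [hf0 x hx]
  have hcont (s : sectionAlgebra n E) :
      IsContinuousSection n E fun x ↦ (f x : ℂ) • (α x * (s : lp E ∞) x * star (α x)) := by
    refine isContinuousSection_iff.2 fun x ↦ ?_
    by_cases hx : x ∈ U
    · obtain ⟨V, t, hV, hxV, hVU, ht⟩ := hL.exists_isLineFrameOn hU hx
      have htx : SectionContinuousWithinAt n t Set.univ x := (ht x hxV).1.mono_of_mem_nhdsWithin
        (mem_nhdsWithin_of_mem_nhds (hV.mem_nhds hxV))
      have heq (y) (hy : y ∈ V) : (f y : ℂ) • (α y * (s : lp E ∞) y * star (α y)) =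
          (f y : ℂ) • (((‖t y‖ ^ 2)⁻¹ : ℝ) : ℂ) • (t y * (s : lp E ∞) y * star (t y)) := by
        rw [smul_mul_mul_star_eq_of_span_eq (hα y (hVU hy)).1 (ht y hy).2.1
          ((hα y (hVU hy)).2 ▸ (ht y hy).2.2)]
      have h1 : ContinuousWithinAt (fun y ↦ (((‖t y‖ ^ 2)⁻¹ : ℝ) : ℂ)) Set.univ x :=
        Complex.continuous_ofReal.continuousAt.comp_continuousWithinAt
          ((htx.norm.pow 2).inv₀ (pow_ne_zero _ (norm_ne_zero_iff.2 (ht x hxV).2.1)))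
      have h2 := (((htx.mul (sectionAlgebra.sectionContinuousWithinAt s _ x)).mul htx.star).smul
        h1).smul (Complex.continuous_ofReal.comp hf).continuousWithinAt
      refine h2.congr_of_eventuallyEq ?_ (heq x hxV)
      filter_upwards [mem_nhdsWithin_of_mem_nhds (hV.mem_nhds hxV)] with y hy
      exact heq y hy
    · refine .of_norm (by simp [hf0 x hx]) ?_
      refine squeeze_zero (fun _ ↦ norm_nonneg _) (fun y ↦ hnorm _ y) ?_
      have := hf.continuousWithinAt.tendsto.mul
        (sectionAlgebra.sectionContinuousWithinAt s Set.univ x).norm.tendsto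
      rwa [hf0 x hx, zero_mul] at this
  have hlim (s : sectionAlgebra n E) : Tendsto (fun x ↦
      ‖(f x : ℂ) • (α x * (s : lp E ∞) x * star (α x))‖) (cocompact X) (𝓝 0) := by
    refine squeeze_zero (fun _ ↦ norm_nonneg _) (fun y ↦ (hnorm _ y).trans
      (mul_le_mul_of_nonneg_right (hf2 y).2 (norm_nonneg _))) ?_
    simpa using (sectionAlgebra.tendsto_norm s).const_mul 2
  choose T hT using fun s ↦ exists_mem_sectionAlgebra (hcont s) (hlim s)
  let T' : sectionAlgebra n E →ₗ[ℂ] sectionAlgebra n E :=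
    { toFun := T
      map_add' := fun s t ↦ sectionAlgebra.ext fun x ↦ by
        change _ = (T s : lp E ∞) x + (T t : lp E ∞) x
        rw [hT, hT, hT, ← smul_add, ← add_mul, ← mul_add]
        rfl
      map_smul' := fun c s ↦ sectionAlgebra.ext fun x ↦ by
        change _ = c • (T s : lp E ∞) x
        rw [hT, hT, smul_comm c, ← smul_mul_assoc c, ← mul_smul_comm c]
        rfl }
  refine ⟨T'.mkContinuous 2 fun s ↦ sectionAlgebra.norm_le (by positivity) fun x ↦ ?_, hT⟩
  change ‖(T s : lp E ∞) x‖ ≤ _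
  rw [hT]
  exact (hnorm _ x).trans (mul_le_mul (hf2 x).2 (sectionAlgebra.norm_apply_le s x)
    (norm_nonneg _) zero_le_two)

/-- Replacing `f` by `(f - ε)⁺` changes the operator by at most `ε` and confines it to the compact
set `{ε ≤ f}`, where `L` has a frame. -/
lemma mem_closure_of_trivial_on_compacts {L : ∀ x, Submodule ℂ (E x)} {U : Set X}
    (hK : ∀ K ⊆ U, IsCompact K → IsTrivialLineBundleOn n L K) {α : ∀ x, E x}
    (hα : ∀ x ∈ U, ‖α x‖ = 1 ∧ L x = ℂ ∙ α x) {f : X → ℝ} (hf : Continuous f)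
    (hf0 : ∀ x, 0 ≤ f x) (hfU : ∀ x, f x ≠ 0 ↔ x ∈ U) (hlim : Tendsto f (cocompact X) (𝓝 0))
    {φ : sectionAlgebra n E →L[ℂ] sectionAlgebra n E}
    (hφ : ∀ s x, (φ s : lp E ∞) x = (f x : ℂ) • (α x * (s : lp E ∞) x * star (α x))) :
    φ ∈ closure (twoSidedMulZero (sectionAlgebra n E)) := by
  refine Metric.mem_closure_iff.2 fun ε' hε' ↦ ?_
  set ε := ε' / 2 with hεdef
  have hε : 0 < ε := half_pos hε'
  have hKU : {x | ε ≤ f x} ⊆ U := fun x hx ↦ (hfU x).1 (hε.trans_le hx).ne'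
  have hKc : IsCompact {x | ε ≤ f x} := by
    obtain ⟨K, hK, hKc⟩ := mem_cocompact.1 (hlim.eventually (gt_mem_nhds hε))
    refine hK.of_isClosed_subset (isClosed_le continuous_const hf) fun x hx ↦ ?_
    by_contra hxK
    have hlt : f x < ε := hKc hxK
    exact not_lt.2 hx hlt
  obtain ⟨s, hs⟩ := (hK _ hKU hKc).exists_isLineFrameOn
  -- The real square root is zero on negative numbers, so `a` vanishes where `f ≤ ε`, whatever `s`
  -- is there.
  let a : ∀ x, E x := fun x ↦ ((√(f x - ε) / ‖s x‖ : ℝ) : ℂ) • s x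
  have hsqrt0 (x) (hx : f x ≤ ε) : √(f x - ε) = 0 := Real.sqrt_eq_zero_of_nonpos (by linarith)
  have hsqrt : Continuous fun x ↦ √(f x - ε) := (hf.sub continuous_const).sqrt
  have han (x) : ‖a x‖ = √(f x - ε) := by
    rcases le_total (f x) ε with hx | hx
    · simp [a, hsqrt0 x hx]
    · have h1 : ‖s x‖ ≠ 0 := norm_ne_zero_iff.2 (hs x hx).2.1
      rw [norm_smul, Complex.norm_of_nonneg (by positivity)]
      field_simp
  have hac : IsContinuousSection n E a := by
    refine isContinuousSection_iff.2 fun x ↦ ?_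
    rcases le_or_gt (f x) ε with hx | hx
    · refine .of_norm (by simp [a, hsqrt0 x hx]) ?_
      simp only [han]
      have := hsqrt.continuousWithinAt (s := Set.univ) (x := x)
      rwa [ContinuousWithinAt, hsqrt0 x hx] at this
    · have hsx : SectionContinuousWithinAt n s Set.univ x :=
        (hs x hx.le).1.mono_of_mem_nhdsWithin (mem_nhdsWithin_of_mem_nhds
          (mem_of_superset ((isOpen_lt continuous_const hf).mem_nhds hx) fun y (hy : ε < f y) ↦ hy.le))
      exact hsx.smul (Complex.continuous_ofReal.continuousAt.comp_continuousWithinAt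
        (hsqrt.continuousWithinAt.div hsx.norm (norm_ne_zero_iff.2 (hs x hx.le).2.1)))
  have halim : Tendsto (fun x ↦ ‖a x‖) (cocompact X) (𝓝 0) := by
    simp only [han]
    have h1 := (Real.continuous_sqrt.tendsto _).comp (hlim.sub_const ε)
    rwa [Real.sqrt_eq_zero_of_nonpos (by linarith : 0 - ε ≤ 0)] at h1
  obtain ⟨a', ha'⟩ := exists_mem_sectionAlgebra hac halim
  refine ⟨(ContinuousLinearMap.mul ℂ _ a').comp ((ContinuousLinearMap.mul ℂ _).flip (star a')),
    ⟨a', star a', fun t ↦ (mul_assoc _ _ _).symm⟩, ?_⟩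
  rw [dist_eq_norm]
  refine (ContinuousLinearMap.opNorm_le_bound _ hε.le fun t ↦ ?_).trans_lt (half_lt_self hε')
  refine sectionAlgebra.norm_le (by positivity) fun x ↦ ?_
  change ‖(φ t : lp E ∞) x - (a' : lp E ∞) x * ((t : lp E ∞) x * star ((a' : lp E ∞) x))‖ ≤ _
  refine le_trans ?_ (mul_le_mul_of_nonneg_left (sectionAlgebra.norm_apply_le t x) hε.le)
  have hαn (v : E x) (hx : x ∈ U) : ‖α x * v * star (α x)‖ ≤ ‖v‖ := by
    refine norm_mul₃_le.trans ?_
    rw [norm_star, (hα x hx).1, one_mul, mul_one]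
  rw [hφ, ha', ← mul_assoc]
  rcases le_or_gt (f x) ε with hx | hx
  · have h0 : a x = 0 := by simp [a, hsqrt0 x hx]
    rw [h0, zero_mul, zero_mul, sub_zero, norm_smul, Complex.norm_of_nonneg (hf0 x)]
    by_cases hxU : x ∈ U
    · exact mul_le_mul hx (hαn _ hxU) (norm_nonneg _) hε.le
    · rw [not_not.1 ((hfU x).not.2 hxU), zero_mul]
      positivity
  · have hxU : x ∈ U := hKU hx.le
    have h1 : ‖s x‖ ≠ 0 := norm_ne_zero_iff.2 (hs x hx.le).2.1
    have h2 : a x * (t : lp E ∞) x * star (a x) =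
        ((f x - ε : ℝ) : ℂ) • (α x * (t : lp E ∞) x * star (α x)) := by
      rw [smul_mul_mul_star_eq_of_span_eq (hα x hxU).1 (hs x hx.le).2.1
        ((hα x hxU).2 ▸ (hs x hx.le).2.2)]
      simp only [a, star_smul, smul_mul_assoc, mul_smul_comm, smul_smul, Complex.star_def,
        Complex.conj_ofReal, ← Complex.ofReal_mul]
      congr 2
      rw [div_mul_div_comm, Real.mul_self_sqrt (by linarith)]
      field_simp
    rw [h2, ← sub_smul, norm_smul, ← Complex.ofReal_sub, sub_sub_cancel,
      Complex.norm_of_nonneg hε.le]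
    exact mul_le_mul_of_nonneg_left (hαn _ hxU) hε.le

lemma exists_scalar_section {f : X → ℝ} (hf : Continuous f)
    (hlim : Tendsto f (cocompact X) (𝓝 0)) :
    ∃ e : sectionAlgebra n E, ∀ x, (e : lp E ∞) x = (f x : ℂ) • (1 : E x) := by
  refine exists_mem_sectionAlgebra (isContinuousSection_iff.2 fun x ↦ ?_) ?_
  · have h0 := isContinuousSection_iff.1 (IsContinuousSection.zero (n := n) (E := E)) x
    have h1 : SectionContinuousWithinAt n (fun x ↦ (1 : E x)) Set.univ x :=
      h0.map₂ (fun _ _ _ ↦ 1) (fun _ _ ↦ 1) continuous_const (fun _ ψ _ _ ↦ map_one ψ) h0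
    exact h1.smul (Complex.continuous_ofReal.comp hf).continuousWithinAt
  · refine squeeze_zero (fun _ ↦ norm_nonneg _) (fun x ↦ ?_) (by simpa using hlim.abs)
    rw [norm_smul, Complex.norm_real, Real.norm_eq_abs]
    refine mul_le_of_le_one_right (abs_nonneg _) ?_
    -- For `n = 0` the fibres are zero and the unit has norm 0.
    rcases subsingleton_or_nontrivial (E x) with h | h
    · rw [Subsingleton.elim (1 : E x) 0, norm_zero]; exact zero_le_one
    · rw [CStarRing.norm_one]

/-- Compression by the central element `f · 1` replaces the multipliers by sections `p` and `q` in
`A`. By uniqueness of the line of the left factor, `p` is a continuous frame of `L` over `U`. -/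
lemma notMem_twoSidedMul_of_not_trivial [T2Space X] [LocallyCompactSpace X]
    {L : ∀ x, Submodule ℂ (E x)} {U : Set X} (hU : ¬ IsTrivialLineBundleOn n L U) {α : ∀ x, E x}
    (hα : ∀ x ∈ U, ‖α x‖ = 1 ∧ L x = ℂ ∙ α x) {f : X → ℝ} (hf : Continuous f)
    (hfU : ∀ x, f x ≠ 0 ↔ x ∈ U) (hlim : Tendsto f (cocompact X) (𝓝 0))
    {φ : sectionAlgebra n E →L[ℂ] sectionAlgebra n E}
    (hφ : ∀ s x, (φ s : lp E ∞) x = (f x : ℂ) • (α x * (s : lp E ∞) x * star (α x))) :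
    φ ∉ twoSidedMul (sectionAlgebra n E) := by
  intro hmem
  obtain ⟨e, he⟩ := exists_scalar_section (n := n) (E := E) hf hlim
  obtain ⟨p, q, hpq⟩ := exists_mul_mul_of_mem_twoSidedMul hmem e
  refine hU (IsLineFrameOn.isTrivialLineBundleOn (s := (p : lp E ∞)) fun x hx ↦ ?_)
  have hα0 : α x ≠ 0 := norm_ne_zero_iff.1 (by rw [(hα x hx).1]; exact one_ne_zero)
  have hfx : (f x : ℂ) ≠ 0 := by exact_mod_cast (hfU x).2 hx
  -- One factor `f x` comes from `φ` and two from the compression.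
  have key (v : E x) : ((f x : ℂ) ^ 3 • α x) * v * star (α x) =
      (p : lp E ∞) x * v * (q : lp E ∞) x := by
    obtain ⟨s, -, rfl⟩ := exists_section_apply_eq (n := n) v
    have h1 : (φ (e * s * e) : lp E ∞) x =
        (p : lp E ∞) x * (s : lp E ∞) x * (q : lp E ∞) x := by rw [hpq]; rfl
    rw [← h1, hφ]
    change _ = (f x : ℂ) • (α x * ((e : lp E ∞) x * (s : lp E ∞) x * (e : lp E ∞) x) * star (α x))
    rw [he]
    simp only [smul_mul_assoc, mul_smul_comm, smul_smul, one_mul, mul_one]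
    congr 1
    ring
  obtain ⟨c, hc, hcp⟩ := exists_smul_eq_of_mul_mul_eq (exists_fiberEquiv n E x).some key
    (smul_ne_zero (pow_ne_zero _ hfx) hα0) (star_ne_zero.2 hα0)
  have hp : (p : lp E ∞) x = (c⁻¹ * (f x : ℂ) ^ 3) • α x := by
    rw [mul_smul, hcp, smul_smul, inv_mul_cancel₀ hc, one_smul]
  have hu : c⁻¹ * (f x : ℂ) ^ 3 ≠ 0 := mul_ne_zero (inv_ne_zero hc) (pow_ne_zero _ hfx)
  refine ⟨sectionAlgebra.sectionContinuousWithinAt p U x, ?_, ?_⟩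
  · rw [hp]
    exact smul_ne_zero hu hα0
  · rw [hp, (hα x hx).2]
    exact (Submodule.span_singleton_smul_eq (IsUnit.mk0 _ hu) _).symm

/-- A phantom line subbundle gives a norm limit of two-sided multiplications by elements of `A`
that is not even a two-sided multiplication by multipliers. -/
lemma exists_mem_closure_notMem_twoSidedMul [T2Space X] [LocallyCompactSpace X] {U : Set X}
    (hU : IsOpen U) (hσ : IsSigmaCompact U) {L : ∀ x, Submodule ℂ (E x)}
    (hL : IsPhantomLineSubbundleOn n L U) :
    ∃ φ ∈ closure (twoSidedMulZero (sectionAlgebra n E)),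
      φ ∉ twoSidedMul (sectionAlgebra n E) := by
  obtain ⟨hL, htriv, hK⟩ := hL
  obtain ⟨f, hf, hf2, hfU, hlim⟩ := exists_continuous_tendsto_of_isSigmaCompact hU hσ
  obtain ⟨α, hα⟩ := hL.exists_unit hU
  obtain ⟨φ, hφ⟩ := exists_continuousLinearMap_conj hU hL hα hf hf2 hfU
  exact ⟨φ, mem_closure_of_trivial_on_compacts hK hα hf (fun x ↦ (hf2 x).1) hfU hlim hφ,
    notMem_twoSidedMul_of_not_trivial htriv hα hf hfU hlim hφ⟩

end PhantomBundles

theorem corollary6p11 {X : Type*} [TopologicalSpace X] [T2Space X] [LocallyCompactSpace X]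
    (n : ℕ) (E : X → Type*) [∀ x, CStarAlgebra (E x)]
    [TopologicalSpace (Bundle.TotalSpace (Matrix (Fin n) (Fin n) ℂ) E)] [IsMatrixBundle n E] :
    (¬ IsClosed (twoSidedMulZero (sectionAlgebra n E)) ↔
      ∃ U : Set X, IsOpen U ∧ IsSigmaCompact U ∧
        ∃ L : ∀ x, Submodule ℂ (E x), IsPhantomLineSubbundleOn n L U) ∧
    (¬ IsClosed (twoSidedMulZero (sectionAlgebra n E)) →
      ¬ IsClosed (twoSidedMul (sectionAlgebra n E))) := by
  refine ⟨⟨exists_isPhantomLineSubbundleOn, ?_⟩, fun h hcl ↦ ?_⟩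
  · rintro ⟨U, hU, hσ, L, hL⟩ hcl
    obtain ⟨φ, hφ, hφ'⟩ := exists_mem_closure_notMem_twoSidedMul hU hσ hL
    exact hφ' (twoSidedMulZero_subset_twoSidedMul (hcl.closure_subset hφ))
  · obtain ⟨U, hU, hσ, L, hL⟩ := exists_isPhantomLineSubbundleOn h
    obtain ⟨φ, hφ, hφ'⟩ := exists_mem_closure_notMem_twoSidedMul hU hσ hL
    exact hφ' (closure_minimal twoSidedMulZero_subset_twoSidedMul hcl hφ)
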